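/- Let $\mathbb K$ be an algebraically closed field of characteristic $0$, $n\ge 1$, and let $v_1,\dots,v_{2n}$ be the standard basis of the vector representation of $\mathfrak{sl}_{2n}(\mathbb K)$, $f_{pq}$ ($p<q$) the matrix unit sending $v_p$ to $v_q$, and $V(\omega_k)=\bigwedge^k\mathbb K^{2n}$. Weights are written in coordinates $\epsilon_1,\dots,\epsilon_{2n}$, where $\epsilon_j$ is the weight of $v_j$; thus $f_{pq}$ has weight $\epsilon_q-\epsilon_p$ and the highest weight vector $v_{\omega_k}=v_1\wedge\dots\wedge v_k$ has weight $\epsilon_1+\dots+\epsilon_k$. For $\zeta\in\mathbb K$ let $V(\omega_k)_\zeta$ be the $\mathfrak{sl}_{2n}\otimes\mathbb K[t]$-module $V(\omega_k)$ on which $x\otimes t^a$ acts as $\zeta^a x$. Let $m_1,\dots,m_{n-1}\ge 0$ be integers, $\lambda=\sum_{k=1}^{n-1}m_k\omega_k$, let $\zeta_{k,i}\in\mathbb K$ ($1\le k\le n-1$, $1\le i\le m_k$) be pairwise distinct, put $$V(\lambda)_{(\zeta_{k,i})}=\bigotimes_{k=1}^{n-1}\bigotimes_{i=1}^{m_k}V(\omega_k)_{\zeta_{k,i}},$$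 and let $v$ be the tensor product of the highest weight vectors. Let $\mathbb B$ be the set of collections $B=(\mathcal B_{k,i})$ of sets of elements $f_{pq}$, $1\le p<q\le 2n$, such that (F1) $p\le k<q$ whenever $f_{pq}\in\mathcal B_{k,i}$; (F2) for any two distinct $f_{p_1q_1},f_{p_2q_2}\in\mathcal B_{k,i}$, either $p_1<p_2$ and $q_2<q_1$, or $p_1>p_2$ and $q_2>q_1$. Order the elements by $f_{ab}<f_{pq}$ iff $b<q$, or $b=q$ and $a<p$ (so $f_{12}<f_{13}<f_{23}<f_{14}<\cdots$). Given $B\in\mathbb B$ and $p<q$, put $\mathcal B'_{k,i}=\mathcal B_{k,i}\cap\{f_{ab}: f_{ab}<f_{pq}\}$, and call $(k,i)$ $(p,q)$-admissible if $\mathcal B'_{k,i}\cup\{f_{pq}\}$ satisfies F1 and F2. Order the $(p,q)$-admissible pairs $(k,i)$ by comparing first the numbers $k-|\mathcal B'_{k,i}|$, then, lexicographically, the vectors of second indices of the elements of $\mathcal B'_{k,i}$ written in decreasing order (a proper initial segment being smaller), then the numbers $i$. For $f_{pq}\in\mathcal B_{k,i}$ let $d(p,q,k,i)$ be the number of $(p,q)$-admissible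 pairs $(k',i')<(k,i)$ with $f_{pq}\notin\mathcal B_{k',i'}$. Put $$\Pi(B)=\prod_{f_{pq}\in\mathcal B_{k,i}}f_{pq}\otimes t^{d(p,q,k,i)}\in U(\mathfrak{sl}_{2n}\otimes\mathbb K[t]),$$ the product over all $(k,i)$ and all $f_{pq}\in\mathcal B_{k,i}$, with smaller $f_{pq}$ to the right, and $\mathcal F(B)=\Pi(B)v$. Let $\mu=\sum_{j=n+1}^{2n}\mu_j\epsilon_j$ with $\mu_j\in\mathbb Z_{\ge 0}$, and let $\mathbb B_\mu$ be the set of $B\in\mathbb B$ such that $\sum_{k,i}\big(\epsilon_1+\dots+\epsilon_k+\sum_{f_{pq}\in\mathcal B_{k,i}}(\epsilon_q-\epsilon_p)\big)=\mu$ in $\bigoplus_{j=1}^{2n}\mathbb Z\epsilon_j$. Then the family $\mathcal F(B)$, $B\in\mathbb B_\mu$, is a basis of the $\mu$-weight space of $V(\lambda)_{(\zeta_{k,i})}$, that is, of the space of vectors on which each diagonal matrix unit $E_{jj}\in\mathfrak{gl}_{2n}$ (acting naturally on $\bigotimes_{k,i}\bigwedge^k\mathbb K^{2n}$) acts as $\mu_j$,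 where $\mu_1=\dots=\mu_n=0$. Moreover, if $\sum_j\mu_j=\sum_k k\,m_k$, this is also the weight space for the Cartan subalgebra of traceless diagonal matrices $h\otimes 1$, i.e. the space of vectors on which each such $h\otimes 1$ acts as $\sum_j\mu_jh_{jj}$. -/

import Mathlib

open scoped TensorProduct Polynomial

noncomputable section

namespace WeylEval

attribute [local instance 100] LieRing.ofAssociativeRing

/-! ### Exterior powers as Lie algebra representations -/

section ExteriorRep

variable {R : Type*} [CommRing R] {M : Type*} [AddCommGroup M] [Module R M]

/-- The multilinear map `(v₁, …, v_k) ↦ ∑ i, v₁ ∧ ⋯ ∧ T vᵢ ∧ ⋯ ∧ v_k`. -/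
def leibnizMulti (k : ℕ) (T : M →ₗ[R] M) : MultilinearMap R (fun _ : Fin k => M) (⋀[R]^k M) :=
  ∑ i : Fin k, (exteriorPower.ιMulti R k (M := M)).toMultilinearMap.compLinearMap
    (Function.update (fun _ => LinearMap.id) i T)

theorem leibnizMulti_apply (k : ℕ) (T : M →ₗ[R] M) (v : Fin k → M) :
    leibnizMulti k T v = ∑ i, exteriorPower.ιMulti R k (Function.update v i (T (v i))) := by
  simp only [leibnizMulti, sum_apply, MultilinearMap.compLinearMap_apply]
  refine Finset.sum_congr rfl fun i _ => ?_
  change exteriorPower.ιMulti R k _ = _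
  congr 1
  funext j
  by_cases h : j = i
  · subst h; simp
  · simp [Function.update_of_ne h]

/-- The alternating map `(v₁, …, v_k) ↦ ∑ i, v₁ ∧ ⋯ ∧ T vᵢ ∧ ⋯ ∧ v_k`. -/
def leibnizAlt (k : ℕ) (T : M →ₗ[R] M) : M [⋀^Fin k]→ₗ[R] (⋀[R]^k M) where
  toMultilinearMap := leibnizMulti k T
  map_eq_zero_of_eq' := by
    intro v a b hab hne
    change leibnizMulti k T v = 0
    rw [leibnizMulti_apply, ← Finset.add_sum_erase _ _ (Finset.mem_univ a),
      ← Finset.add_sum_erase _ _ (Finset.mem_erase.2 ⟨hne.symm, Finset.mem_univ b⟩),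
      Finset.sum_eq_zero, add_zero]
    · have h : Function.update v b (T (v b)) =
          Function.update v a (T (v a)) ∘ Equiv.swap a b := by
        funext j
        by_cases h1 : j = a
        · subst h1; simp [Function.update_of_ne hne, hab, Function.update_of_ne hne.symm]
        · by_cases h2 : j = b
          · subst h2; simp [hab]
          · simp [Equiv.swap_apply_of_ne_of_ne h1 h2, Function.update_of_ne h1,
              Function.update_of_ne h2]
      rw [h, AlternatingMap.map_swap _ _ hne, add_neg_cancel]
    · intro c hc
      simp only [Finset.mem_erase, Finset.mem_univ, and_true] at hc
      refine AlternatingMap.map_eq_zero_of_eq _ _ (i := a) (j := b) ?_ hne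
      rw [Function.update_of_ne hc.2.symm, Function.update_of_ne hc.1.symm, hab]

theorem leibnizAlt_apply (k : ℕ) (T : M →ₗ[R] M) (v : Fin k → M) :
    leibnizAlt k T v = ∑ i, exteriorPower.ιMulti R k (Function.update v i (T (v i))) :=
  leibnizMulti_apply k T v

/-- The linear map `v₁ ∧ ⋯ ∧ v_k ↦ ∑ i, v₁ ∧ ⋯ ∧ T vᵢ ∧ ⋯ ∧ v_k` on `⋀^k M`. -/
def leibniz (k : ℕ) (T : M →ₗ[R] M) : ⋀[R]^k M →ₗ[R] ⋀[R]^k M :=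
  exteriorPower.alternatingMapLinearEquiv (leibnizAlt k T)

theorem leibniz_apply_ιMulti (k : ℕ) (T : M →ₗ[R] M) (v : Fin k → M) :
    leibniz k T (exteriorPower.ιMulti R k v) =
      ∑ i, exteriorPower.ιMulti R k (Function.update v i (T (v i))) := by
  simp only [leibniz, exteriorPower.alternatingMapLinearEquiv_apply_ιMulti, leibnizAlt_apply]

theorem leibniz_comp_apply (k : ℕ) (S T : M →ₗ[R] M) (v : Fin k → M) :
    leibniz k S (leibniz k T (exteriorPower.ιMulti R k v)) =
      ∑ i, (exteriorPower.ιMulti R k (Function.update v i (S (T (v i)))) +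
        ∑ j ∈ Finset.univ.erase i, exteriorPower.ιMulti R k
          (Function.update (Function.update v i (T (v i))) j (S (v j)))) := by
  rw [leibniz_apply_ιMulti, map_sum]
  refine Finset.sum_congr rfl fun i _ => ?_
  rw [leibniz_apply_ιMulti, ← Finset.add_sum_erase _ _ (Finset.mem_univ i)]
  congr 1
  · simp
  · refine Finset.sum_congr rfl fun j hj => ?_
    rw [Function.update_of_ne (Finset.ne_of_mem_erase hj)]

/-- The natural representation of `𝔤𝔩(M)` on `⋀^k M`:
`T · (v₁ ∧ ⋯ ∧ v_k) = ∑ i, v₁ ∧ ⋯ ∧ T vᵢ ∧ ⋯ ∧ v_k`. -/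
def exteriorRep (R : Type*) [CommRing R] (M : Type*) [AddCommGroup M] [Module R M] (k : ℕ) :
    Module.End R M →ₗ⁅R⁆ Module.End R (⋀[R]^k M) where
  toFun T := leibniz k T
  map_add' S T := by
    apply exteriorPower.linearMap_ext
    ext1 v
    simp [leibniz_apply_ιMulti, Finset.sum_add_distrib]
  map_smul' c T := by
    apply exteriorPower.linearMap_ext
    ext1 v
    simp [leibniz_apply_ιMulti, Finset.smul_sum]
  map_lie' {S T} := by
    apply exteriorPower.linearMap_ext
    ext1 v
    simp only [LinearMap.compAlternatingMap_apply, Ring.lie_def, LinearMap.sub_apply,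
      Module.End.mul_apply]
    rw [leibniz_comp_apply, leibniz_comp_apply, leibniz_apply_ιMulti]
    simp only [Finset.sum_add_distrib]
    have hcomm : (∑ i, ∑ j ∈ Finset.univ.erase i, exteriorPower.ιMulti R k
          (Function.update (Function.update v i (T (v i))) j (S (v j)))) =
        ∑ i, ∑ j ∈ Finset.univ.erase i, exteriorPower.ιMulti R k
          (Function.update (Function.update v i (S (v i))) j (T (v j))) := by
      rw [Finset.sum_comm' (t' := Finset.univ) (s' := fun j => Finset.univ.erase j)
        (by intro i j; simp [ne_comm])]
      refine Finset.sum_congr rfl fun i _ => Finset.sum_congr rfl fun j hj => ?_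
      rw [Function.update_comm (Finset.ne_of_mem_erase hj)]
    rw [hcomm, add_sub_add_right_eq_sub, ← Finset.sum_sub_distrib]
    refine Finset.sum_congr rfl fun i _ => ?_
    simp

theorem exteriorRep_apply_ιMulti (k : ℕ) (T : Module.End R M) (v : Fin k → M) :
    exteriorRep R M k T (exteriorPower.ιMulti R k v) =
      ∑ i, exteriorPower.ιMulti R k (Function.update v i (T (v i))) :=
  leibniz_apply_ιMulti k T v

end ExteriorRep

/-! ### Tensor products of representations -/

/-- The tensor product of a finite family of representations:
`x ↦ ∑ i, 1 ⊗ ⋯ ⊗ ρᵢ x ⊗ ⋯ ⊗ 1`. -/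
def tensorRep {R : Type*} [CommRing R] {L : Type*} [LieRing L] [LieAlgebra R L]
    {ι : Type*} [Fintype ι] [DecidableEq ι] {V : ι → Type*} [∀ i, AddCommGroup (V i)]
    [∀ i, Module R (V i)] (ρ : ∀ i, L →ₗ⁅R⁆ Module.End R (V i)) :
    L →ₗ⁅R⁆ Module.End R (⨂[R] i, V i) where
  toFun x := ∑ i, PiTensorProduct.map (Pi.mulSingle i (ρ i x) : ∀ j, Module.End R (V j))
  map_add' x y := by
    rw [← Finset.sum_add_distrib]
    refine Finset.sum_congr rfl fun i _ => ?_
    rw [map_add]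
    exact PiTensorProduct.map_update_add _ i _ _
  map_smul' c x := by
    rw [RingHom.id_apply, Finset.smul_sum]
    refine Finset.sum_congr rfl fun i _ => ?_
    rw [map_smul]
    exact PiTensorProduct.map_update_smul _ i c _
  map_lie' {x y} := by
    rw [Ring.lie_def, Finset.sum_mul_sum, Finset.sum_mul_sum, Finset.sum_comm,
      ← Finset.sum_sub_distrib]
    refine Finset.sum_congr rfl fun i _ => ?_
    rw [← Finset.sum_sub_distrib, Finset.sum_eq_single i]
    · rw [← PiTensorProduct.map_mul, ← PiTensorProduct.map_mul]
      have h : ∀ a b : Module.End R (V i),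
          (fun j => (Pi.mulSingle i a : ∀ j, Module.End R (V j)) j *
            (Pi.mulSingle i b : ∀ j, Module.End R (V j)) j) = Pi.mulSingle i (a * b) := by
        intro a b
        exact (Pi.mulSingle_mul (f := fun j => Module.End R (V j)) i a b).symm
      rw [h, h, eq_sub_iff_add_eq, LieHom.map_lie, Ring.lie_def]
      refine (PiTensorProduct.map_update_add _ i _ _).symm.trans ?_
      rw [sub_add_cancel]
      rfl
    · intro j _ hj
      rw [← PiTensorProduct.map_mul, ← PiTensorProduct.map_mul, sub_eq_zero]
      congr 1
      exact Pi.mulSingle_commute hj _ _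
    · simp

theorem tensorRep_tprod {R : Type*} [CommRing R] {L : Type*} [LieRing L] [LieAlgebra R L]
    {ι : Type*} [Fintype ι] [DecidableEq ι] {V : ι → Type*} [∀ i, AddCommGroup (V i)]
    [∀ i, Module R (V i)] (ρ : ∀ i, L →ₗ⁅R⁆ Module.End R (V i)) (x : L) (v : ∀ i, V i) :
    tensorRep ρ x (PiTensorProduct.tprod R v) =
      ∑ i, PiTensorProduct.tprod R (Function.update v i (ρ i x (v i))) := by
  change (∑ i, PiTensorProduct.map (Pi.mulSingle i (ρ i x) : ∀ j, Module.End R (V j))) _ = _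
  rw [LinearMap.sum_apply]
  refine Finset.sum_congr rfl fun i _ => ?_
  rw [PiTensorProduct.map_tprod]
  congr 1
  funext j
  by_cases h : j = i
  · subst h; simp
  · simp [h]

/-! ### The current algebra and evaluation -/

/-- `𝔰𝔩_N` over `K`. -/
abbrev slN (K : Type*) [Field K] (N : ℕ) := LieAlgebra.SpecialLinear.sl (Fin N) K

/-- The current algebra `𝔰𝔩_N ⊗ K[t]`. -/
abbrev Current (K : Type*) [Field K] (N : ℕ) := K[X] ⊗[K] slN K N

/-- The linear map `x ⊗ t^a ↦ ζ^a x` from `L ⊗ K[t]` to `L`. -/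
def evalLin {K : Type*} [Field K] {L : Type*} [LieRing L] [LieAlgebra K L] (ζ : K) :
    (K[X] ⊗[K] L) →ₗ[K] L :=
  TensorProduct.lift ((LinearMap.lsmul K L).comp
    (Polynomial.aeval (R := K) ζ).toLinearMap)

theorem evalLin_tmul {K : Type*} [Field K] {L : Type*} [LieRing L] [LieAlgebra K L] (ζ : K)
    (P : K[X]) (x : L) : evalLin ζ (P ⊗ₜ[K] x) = P.eval ζ • x := by
  simp [evalLin, Polynomial.coe_aeval_eq_eval]

/-- The Lie algebra homomorphism `x ⊗ t^a ↦ ζ^a x` from `L ⊗ K[t]` to `L`. -/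
def evalHom {K : Type*} [Field K] {L : Type*} [LieRing L] [LieAlgebra K L] (ζ : K) :
    (K[X] ⊗[K] L) →ₗ⁅K⁆ L where
  toLinearMap := evalLin ζ
  map_lie' {x y} := by
    change evalLin ζ ⁅x, y⁆ = ⁅evalLin ζ x, evalLin ζ y⁆
    induction x using TensorProduct.induction_on with
    | zero => exact (congrArg _ (zero_lie y)).trans (by simp)
    | add a b ha hb =>
      exact (congrArg _ (add_lie a b y)).trans (by rw [map_add, ha, hb, map_add, add_lie])
    | tmul P x =>
      induction y using TensorProduct.induction_on with
      | zero => exact (congrArg _ (lie_zero (P ⊗ₜ[K] x))).trans (by simp)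
      | add a b ha hb =>
        exact (congrArg _ (lie_add (P ⊗ₜ[K] x) a b)).trans (by rw [map_add, ha, hb, map_add, lie_add])
      | tmul Q y =>
        rw [LieAlgebra.ExtendScalars.bracket_tmul]
        simp only [evalLin_tmul, Polynomial.eval_mul, lie_smul, smul_lie, smul_smul]
        rw [mul_comm]

theorem evalHom_tmul {K : Type*} [Field K] {L : Type*} [LieRing L] [LieAlgebra K L] (ζ : K)
    (a : ℕ) (x : L) : evalHom ζ ((Polynomial.X ^ a : K[X]) ⊗ₜ[K] x) = ζ ^ a • x := by
  change evalLin ζ _ = _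
  simp [evalLin_tmul]

/-- The natural action of `N × N` matrices on `K^N`, as a Lie algebra homomorphism. -/
def matRep (K : Type*) [Field K] (N : ℕ) :
    Matrix (Fin N) (Fin N) K →ₗ⁅K⁆ Module.End K (Fin N → K) :=
  (lieEquivMatrix' (R := K) (n := Fin N)).symm.toLieHom

theorem matRep_apply (K : Type*) [Field K] (N : ℕ) (A : Matrix (Fin N) (Fin N) K)
    (v : Fin N → K) : matRep K N A v = A.mulVec v := by
  rfl

/-- The matrix unit `f_{pq}` of `𝔰𝔩_N` sending `v_p` to `v_q` (for `p ≠ q`; it is only used for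
`p < q`). -/
def fElt (K : Type*) [Field K] {N : ℕ} (p q : Fin N) : slN K N :=
  if h : q ≠ p then LieAlgebra.SpecialLinear.single q p h 1 else 0

/-- The fundamental module `V(ω_k) = ⋀^k K^N` of `𝔰𝔩_N`. -/
abbrev Fund (K : Type*) [Field K] (N k : ℕ) : Type _ := ⋀[K]^k (Fin N → K)

instance (K : Type*) [Field K] (N k : ℕ) : AddCommGroup (Fund K N k) := inferInstance

instance (K : Type*) [Field K] (N k : ℕ) : AddCommMonoid (Fund K N k) :=
  AddCommGroup.toAddCommMonoid

/-- The action of `𝔤𝔩_N` on `⋀^k K^N`. -/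
def glFundRep (K : Type*) [Field K] (N k : ℕ) :
    Matrix (Fin N) (Fin N) K →ₗ⁅K⁆ Module.End K (Fund K N k) :=
  (exteriorRep K (Fin N → K) k).comp (matRep K N)

/-- The action of `𝔰𝔩_N` on `V(ω_k)`. -/
def fundRep (K : Type*) [Field K] (N k : ℕ) : slN K N →ₗ⁅K⁆ Module.End K (Fund K N k) :=
  (glFundRep K N k).comp (LieAlgebra.SpecialLinear.sl (Fin N) K).incl

/-- The evaluation module `V(ω_k)_ζ`: `x ⊗ t^a` acts as `ζ^a x`. -/
def evalRep (K : Type*) [Field K] (N k : ℕ) (ζ : K) :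
    Current K N →ₗ⁅K⁆ Module.End K (Fund K N k) :=
  (fundRep K N k).comp (evalHom ζ)

/-- The highest weight vector `v_1 ∧ ⋯ ∧ v_k` of `V(ω_k)` (for `k ≤ N`). -/
def hwVec (K : Type*) [Field K] (N k : ℕ) : Fund K N k :=
  exteriorPower.ιMulti K k fun i j => if j.val = i.val then 1 else 0

/-! ### The tensor product of fundamental evaluation modules

`m k` (with `k : Fin (n - 1)`) is the multiplicity of `ω_{k+1}` in the highest weight
`λ = ∑ m_k ω_k`, where `1 ≤ k + 1 ≤ n - 1`. -/

/-- The pairs `(k, i)`, `1 ≤ k ≤ n - 1`, `1 ≤ i ≤ m_k`, both coordinates shifted to start at `0`. -/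
abbrev Slot (n : ℕ) (m : Fin (n - 1) → ℕ) := Σ k : Fin (n - 1), Fin (m k)

/-- The number `k` of a pair `(k, i)`, so that the corresponding tensor factor is `V(ω_k)`. -/
def Slot.deg {n : ℕ} {m : Fin (n - 1) → ℕ} (s : Slot n m) : ℕ := s.1.val + 1

/-- The space `⨂_{k,i} V(ω_k)`, with `V(ω_k)` the fundamental modules of `𝔰𝔩_{2n}`. -/
abbrev TensorSpace (K : Type*) [Field K] (n : ℕ) (m : Fin (n - 1) → ℕ) : Type _ :=
  ⨂[K] s : Slot n m, Fund K (2 * n) s.deg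

/-- The module `V(λ)_{(ζ_{k,i})} = ⨂_{k,i} V(ω_k)_{ζ_{k,i}}` over `𝔰𝔩_{2n} ⊗ K[t]`. -/
def evalTensorRep (K : Type*) [Field K] (n : ℕ) (m : Fin (n - 1) → ℕ) (ζ : Slot n m → K) :
    Current K (2 * n) →ₗ⁅K⁆ Module.End K (TensorSpace K n m) :=
  tensorRep fun s => evalRep K (2 * n) s.deg (ζ s)

/-- The cyclic vector `v`, the tensor product of the highest weight vectors. -/
def cyclicVec (K : Type*) [Field K] (n : ℕ) (m : Fin (n - 1) → ℕ) : TensorSpace K n m :=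
  PiTensorProduct.tprod K fun s => hwVec K (2 * n) s.deg

/-- The action of `𝔤𝔩_{2n}` on `⨂_{k,i} ⋀^k K^{2n}`. -/
def glTensorRep (K : Type*) [Field K] (n : ℕ) (m : Fin (n - 1) → ℕ) :
    Matrix (Fin (2 * n)) (Fin (2 * n)) K →ₗ⁅K⁆ Module.End K (TensorSpace K n m) :=
  tensorRep fun s => glFundRep K (2 * n) s.deg

/-- The space of vectors of weight `∑ j, μ j ε_j`, where `ε_j` is the weight of `v_j`: the diagonal
matrix unit `E_jj` acts on it as `μ j`. -/
def weightSpace (K : Type*) [Field K] (n : ℕ) (m : Fin (n - 1) → ℕ) (μ : Fin (2 * n) → ℕ) :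
    Submodule K (TensorSpace K n m) :=
  ⨅ j, Module.End.eigenspace (glTensorRep K n m (Matrix.single j j 1)) (μ j : K)

/-- The weight space of the `𝔰𝔩_{2n}`-weight `∑ j, μ j ε_j`: every traceless diagonal matrix `h`,
that is `h ⊗ 1` in the current algebra, acts on it as `∑ j, μ j h_jj`. -/
def slWeightSpace (K : Type*) [Field K] (n : ℕ) (m : Fin (n - 1) → ℕ) (ζ : Slot n m → K)
    (μ : Fin (2 * n) → ℕ) : Submodule K (TensorSpace K n m) :=
  ⨅ h : {h : slN K (2 * n) // h.val.IsDiag},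
    Module.End.eigenspace (evalTensorRep K n m ζ ((1 : K[X]) ⊗ₜ[K] h.val))
      (∑ j, (μ j : K) * h.val.val j j)

/-! ### Combinatorics

The pair `(p, q)` stands for `f_{pq}`; indices `1, …, 2n` are shifted to `0, …, 2n - 1`. -/

/-- Conditions F1 and F2 on a set of elements `f_{pq}` placed in a factor `V(ω_k)`. The first
one is `p ≤ k < q` for indices starting at `1`. -/
def IsFilling {N : ℕ} (k : ℕ) (S : Finset (Fin N × Fin N)) : Prop :=
  (∀ a ∈ S, a.1.val < k ∧ k ≤ a.2.val) ∧
  ∀ a ∈ S, ∀ b ∈ S, a ≠ b → (a.1 < b.1 ∧ b.2 < a.2) ∨ (b.1 < a.1 ∧ a.2 < b.2)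

instance {N : ℕ} (k : ℕ) (S : Finset (Fin N × Fin N)) : Decidable (IsFilling k S) := by
  unfold IsFilling
  exact instDecidableAnd

/-- Collections of finite sets of elements `f_{pq}`, one for each pair `(k, i)`. -/
abbrev Coll (n : ℕ) (m : Fin (n - 1) → ℕ) := Slot n m → Finset (Fin (2 * n) × Fin (2 * n))

/-- The set `𝔹` of collections satisfying F1 and F2. -/
def fillings (n : ℕ) (m : Fin (n - 1) → ℕ) : Set (Coll n m) :=
  {B | ∀ s, IsFilling s.deg (B s)}

/-- The order `f_12 < f_13 < f_23 < f_14 < f_24 < f_34 < ⋯`. -/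
def fLT {N : ℕ} (a b : Fin N × Fin N) : Prop := a.2 < b.2 ∨ (a.2 = b.2 ∧ a.1 < b.1)

instance {N : ℕ} (a b : Fin N × Fin N) : Decidable (fLT a b) := by
  unfold fLT; infer_instance

/-- The restriction of a collection to the elements less than `f_{pq}`. -/
def restrict {n : ℕ} {m : Fin (n - 1) → ℕ} (B : Coll n m) (pq : Fin (2 * n) × Fin (2 * n)) :
    Coll n m :=
  fun s => (B s).filter fun ab => fLT ab pq

/-- `(k, i)` is `(p,q)`-admissible: adding `f_{pq}` to the restricted set preserves F1 and F2. -/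
def Admissible {n : ℕ} {m : Fin (n - 1) → ℕ} (B : Coll n m) (pq : Fin (2 * n) × Fin (2 * n))
    (s : Slot n m) : Prop :=
  IsFilling s.deg (insert pq (restrict B pq s))

instance {n : ℕ} {m : Fin (n - 1) → ℕ} (B : Coll n m) (pq : Fin (2 * n) × Fin (2 * n))
    (s : Slot n m) : Decidable (Admissible B pq s) := by
  unfold Admissible; infer_instance

/-- The vector `(q_l, …, q_1)` of the second indices of a set of elements `f_{pq}`, in decreasing
order. -/
def qVec {N : ℕ} (S : Finset (Fin N × Fin N)) : List (Fin N) :=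
  (S.image Prod.snd).sort (· ≥ ·)

/-- The order on pairs `(k, i)` given a (restricted) collection `B'`: compare the numbers `k - l`,
`l` being the cardinality of the set at `(k, i)`, then the vectors `(q_l, …, q_1)`
lexicographically, then the numbers `i`. -/
def SlotLT {n : ℕ} {m : Fin (n - 1) → ℕ} (B' : Coll n m) (s s' : Slot n m) : Prop :=
  (s.deg : ℤ) - (B' s).card < (s'.deg : ℤ) - (B' s').card ∨
  ((s.deg : ℤ) - (B' s).card = (s'.deg : ℤ) - (B' s').card ∧
    (qVec (B' s) < qVec (B' s') ∨ (qVec (B' s) = qVec (B' s') ∧ s.2.val < s'.2.val)))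

instance {n : ℕ} {m : Fin (n - 1) → ℕ} (B' : Coll n m) (s s' : Slot n m) :
    Decidable (SlotLT B' s s') := by
  unfold SlotLT; infer_instance

/-- The degree `d(p, q, k, i)`: the number of `(p,q)`-admissible pairs less than `(k, i)` whose set
does not contain `f_{pq}`. -/
def tDeg {n : ℕ} {m : Fin (n - 1) → ℕ} (B : Coll n m) (pq : Fin (2 * n) × Fin (2 * n))
    (s : Slot n m) : ℕ :=
  (Finset.univ.filter fun s' : Slot n m =>
    Admissible B pq s' ∧ SlotLT (restrict B pq) s' s ∧ pq ∉ B s').card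

/-- All pairs `(p, q)` in decreasing order with respect to `fLT`. -/
def pairsDesc (N : ℕ) : List (Fin N × Fin N) :=
  (List.finRange N).reverse.flatMap fun q => (List.finRange N).reverse.map fun p => (p, q)

/-- The list of all pairs `(k, i)`. -/
def slotList (n : ℕ) (m : Fin (n - 1) → ℕ) : List (Slot n m) :=
  (List.finRange (n - 1)).flatMap fun k => (List.finRange (m k)).map fun i => ⟨k, i⟩

/-- `Π(B) = ∏ f_{pq} ⊗ t^{d(p,q,k,i)}` in `U(𝔰𝔩_{2n} ⊗ K[t])`, the smaller `f_{pq}` to the right.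
Factors with the same `f_{pq}` commute, so their relative order is immaterial. -/
def piElt (K : Type*) [Field K] {n : ℕ} {m : Fin (n - 1) → ℕ} (B : Coll n m) :
    UniversalEnvelopingAlgebra K (Current K (2 * n)) :=
  ((pairsDesc (2 * n)).map fun pq =>
    (((slotList n m).filter fun s => pq ∈ B s).map fun s =>
      UniversalEnvelopingAlgebra.ι K
        ((Polynomial.X ^ tDeg B pq s : K[X]) ⊗ₜ[K] fElt K pq.1 pq.2)).prod).prod

/-- `𝓕(B) = Π(B) v`. -/
def fVec (K : Type*) [Field K] {n : ℕ} {m : Fin (n - 1) → ℕ} (ζ : Slot n m → K) (B : Coll n m) :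
    TensorSpace K n m :=
  UniversalEnvelopingAlgebra.lift K (evalTensorRep K n m ζ) (piElt K B) (cyclicVec K n m)

/-- The weight `∑_{k,i} (ε_1 + ⋯ + ε_k) + ∑_{k,i} ∑_{f_pq ∈ B_{k,i}} (ε_q - ε_p)` of `Π(B) v`,
in the coordinates `ε_j`. -/
def collWeight {n : ℕ} {m : Fin (n - 1) → ℕ} (B : Coll n m) : Fin (2 * n) → ℤ := fun j =>
  ∑ s, ((if j.val < s.deg then 1 else 0) +
    ∑ pq ∈ B s, ((if pq.2 = j then 1 else 0) - (if pq.1 = j then 1 else 0)))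

/-- The set `𝔹_μ` of collections in `𝔹` of weight `μ`. -/
def fillingsOfWeight (n : ℕ) (m : Fin (n - 1) → ℕ) (μ : Fin (2 * n) → ℕ) : Set (Coll n m) :=
  {B | B ∈ fillings n m ∧ ∀ j, collWeight B j = μ j}

end WeylEval

end

noncomputable section

namespace WeylEval

attribute [local instance 100] LieRing.ofAssociativeRing

/-! Every tensor factor is `⋀^k` with `k < n`, and `μ` vanishes on the first `n` coordinates. So
only `f_{pq}` with first index at most `n` and second index above `n` occur in `𝔹_μ`. These commute,
and `Π(B)` depends only on the multiset of exponents carried by each `f_{pq}`. The weight space has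
the basis of tensors `wedge K w` in which every factor has a strictly decreasing sequence of
entries, all above `n`. Each element of `𝔹_μ` is `collOf w` for such a `w` (`exists_eq_collOf`).
Hence there are at most as many vectors `𝓕(B)` as the dimension, and it suffices that they span.

Spanning. Fix a decreasing `w`. For a pair `(p, q)`, call a slot ready if its entry at position `p`
is at least `q` and the next one is below `q`. Let `gapPoly` vanish exactly at the parameters of the
ready slots that do not have `q` at `p`. Multiply the elements `f_{pq}`, with `gapPoly` as
current-algebra coefficient, over all cells of `w`, and apply the product to `v`. The result is a
nonzero multiple of a sum over all `w'` with the same number of each entry at each position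
(`prod_lowering_cyclicVec`). The coefficient of `w` is nonzero because the parameters are distinct.
A decreasing `w' ≠ w` has coefficient zero: at the smallest entry where the two differ, the ready
slots still agree, so `w'` uses a root (`eq_of_coeff_gapPoly_ne_zero`). A non-decreasing `w'`
contributes zero or, after a transposition, a tensor of smaller energy. Induction on the energy puts
`wedge K w` in the span, provided the product applied to `v` lies there.

For that, expand the polynomials. Each `f_{pq}` occurs with exponents at most `#ready - #placed`. A
multiset of `c` numbers at most `#A - c` is realized by a `c`-subset of the ordered set `A`, as the
numbers of unchosen elements below the chosen ones. Choosing subsets of ready slots for increasing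
`q` realizes every such monomial (`exists_columns_of_gaps`), because the number of ready slots
depends only on the numbers of smaller entries. The order on admissible pairs makes these gap
numbers equal to `d(p,q,k,i)` (`tDeg_collOf`). -/

variable {K : Type*} [Field K] {n : ℕ} {m : Fin (n - 1) → ℕ}

/-! ### Tensors of basis wedges and the action of matrix units -/

/-- The pairs of a tensor factor `⋀^k K^{2n}` and a position in its wedge products. -/
abbrev Cell (n : ℕ) (m : Fin (n - 1) → ℕ) := Σ s : Slot n m, Fin s.deg

/-- The tensor product of the wedge products of basis vectors with the indices `w`. -/
def wedge (K : Type*) [Field K] (w : Cell n m → Fin (2 * n)) : TensorSpace K n m :=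
  PiTensorProduct.tprod K fun s =>
    exteriorPower.ιMulti K s.deg fun i => Pi.single (w ⟨s, i⟩) (1 : K)

theorem glFundRep_single (k : ℕ) {N : ℕ} (a b : Fin N) (v : Fin k → Fin N) :
    glFundRep K N k (Matrix.single a b 1)
        (exteriorPower.ιMulti K k fun i => Pi.single (v i) (1 : K)) =
      ∑ i, if v i = b then
        exteriorPower.ιMulti K k fun j => Pi.single (Function.update v i a j) (1 : K) else 0 := by
  change exteriorRep K (Fin N → K) k (matRep K N _) _ = _
  rw [exteriorRep_apply_ιMulti]
  refine Finset.sum_congr rfl fun i _ => ?_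
  rw [matRep_apply]
  split_ifs with h
  · congr 1
    funext j
    by_cases hj : j = i
    · subst hj
      simp [h, Matrix.single_mulVec, Function.update_self, Pi.single]
    · simp [Function.update_of_ne hj]
  · refine AlternatingMap.map_coord_zero _ i ?_
    rw [Matrix.mulVec_single_one]
    funext j
    simp [Ne.symm h]

/-- The scalars `c` let one computation serve two actions: `c = 1` gives `glTensorRep`, and `c s =
P(ζ s)` gives the evaluation module. -/
theorem sum_tprod_update_single (c : Slot n m → K) (a b : Fin (2 * n))
    (w : Cell n m → Fin (2 * n)) :
    ∑ s, PiTensorProduct.tprod K (Function.update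
      (fun s => exteriorPower.ιMulti K s.deg fun i => Pi.single (w ⟨s, i⟩) (1 : K)) s
        (c s • glFundRep K (2 * n) s.deg (Matrix.single a b 1)
          (exteriorPower.ιMulti K s.deg fun i => Pi.single (w ⟨s, i⟩) (1 : K)))) =
      ∑ x : Cell n m, if w x = b then c x.1 • wedge K (Function.update w x a) else 0 := by
  refine Eq.trans ?_ (Fintype.sum_sigma _).symm
  refine Finset.sum_congr rfl fun s _ => ?_
  rw [MultilinearMap.map_update_smul, glFundRep_single, MultilinearMap.map_update_sum,
    Finset.smul_sum]
  refine Finset.sum_congr rfl fun i _ => ?_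
  split_ifs with h
  · congr 1
    rw [wedge]
    congr 1
    funext s'
    by_cases hs : s' = s
    · subst hs
      rw [Function.update_self]
      congr 1
      funext j
      congr 1
      by_cases hj : j = i
      · subst hj; simp
      · rw [Function.update_of_ne hj, Function.update_of_ne]
        simpa using hj
    · rw [Function.update_of_ne hs]
      congr 1
      funext j
      rw [Function.update_of_ne]
      intro h'
      exact hs (congrArg Sigma.fst h')
  · rw [MultilinearMap.map_update_zero, smul_zero]

theorem glTensorRep_single_wedge (a b : Fin (2 * n)) (w : Cell n m → Fin (2 * n)) :
    glTensorRep K n m (Matrix.single a b 1) (wedge K w) =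
      ∑ x : Cell n m, if w x = b then wedge K (Function.update w x a) else 0 := by
  rw [glTensorRep, wedge, tensorRep_tprod]
  simpa using sum_tprod_update_single (K := K) (fun _ => 1) a b w

theorem glTensorRep_diag_wedge (j : Fin (2 * n)) (w : Cell n m → Fin (2 * n)) :
    glTensorRep K n m (Matrix.single j j 1) (wedge K w) =
      ((Finset.univ.filter fun x => w x = j).card : K) • wedge K w := by
  rw [glTensorRep_single_wedge, ← Finset.sum_filter, Nat.cast_smul_eq_nsmul, ← Finset.sum_const]
  refine Finset.sum_congr rfl fun x hx => ?_
  rw [← (Finset.mem_filter.1 hx).2, Function.update_eq_self]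

/-- The action of `f_{pq} ⊗ P(t)` on the tensor product of evaluation modules. -/
def lowering (ζ : Slot n m → K) (pq : Fin (2 * n) × Fin (2 * n)) (P : K[X]) :
    Module.End K (TensorSpace K n m) :=
  evalTensorRep K n m ζ (P ⊗ₜ[K] fElt K pq.1 pq.2)

theorem lowering_wedge (ζ : Slot n m → K) (pq : Fin (2 * n) × Fin (2 * n)) (h : pq.1 ≠ pq.2)
    (P : K[X]) (w : Cell n m → Fin (2 * n)) :
    lowering ζ pq P (wedge K w) = ∑ x : Cell n m,
      if w x = pq.1 then P.eval (ζ x.1) • wedge K (Function.update w x pq.2) else 0 := by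
  rw [lowering, evalTensorRep, wedge, tensorRep_tprod,
    ← sum_tprod_update_single (K := K) (fun s => P.eval (ζ s)) pq.2 pq.1 w]
  refine Finset.sum_congr rfl fun s _ => ?_
  congr 2
  change fundRep K (2 * n) s.deg (evalLin (ζ s) _) _ = _
  rw [evalLin_tmul, map_smul, fElt, dif_pos h.symm]
  rfl

/-- Two matrix units whose indices do not chain have both products zero, so their bracket vanishes
with any polynomial coefficients. -/
theorem lowering_commute (ζ : Slot n m → K) (a b : Fin (2 * n) × Fin (2 * n))
    (ha : a.1 ≠ a.2) (hb : b.1 ≠ b.2) (hab : a.1 ≠ b.2) (hba : b.1 ≠ a.2) (P Q : K[X]) :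
    Commute (lowering ζ a P) (lowering ζ b Q) := by
  refine sub_eq_zero.1 (?_ : ⁅lowering ζ a P, lowering ζ b Q⁆ = 0)
  rw [lowering, lowering, ← LieHom.map_lie, LieAlgebra.ExtendScalars.bracket_tmul]
  have : ⁅fElt K a.1 a.2, fElt K b.1 b.2⁆ = 0 := by
    rw [fElt, fElt, dif_pos ha.symm, dif_pos hb.symm]
    apply Subtype.ext
    rw [LieSubalgebra.coe_bracket, Ring.lie_def]
    change Matrix.single _ _ _ * Matrix.single _ _ _ - Matrix.single _ _ _ * Matrix.single _ _ _ = _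
    rw [Matrix.single_mul_single_of_ne _ _ _ _ hab, Matrix.single_mul_single_of_ne _ _ _ _ hba]
    simp
  rw [this, TensorProduct.tmul_zero, map_zero]

theorem lowering_linear (ζ : Slot n m → K) (pq : Fin (2 * n) × Fin (2 * n)) (P : K[X]) (d : ℕ)
    (hd : P.natDegree ≤ d) :
    lowering ζ pq P ∈ Submodule.span K (Set.range fun i : Fin (d + 1) =>
      lowering ζ pq (Polynomial.X ^ i.val)) := by
  rw [P.as_sum_range_C_mul_X_pow' (Nat.lt_succ_of_le hd), lowering,
    TensorProduct.sum_tmul, map_sum]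
  refine Submodule.sum_mem _ fun i hi => ?_
  rw [Polynomial.C_mul', ← TensorProduct.smul_tmul', map_smul]
  exact Submodule.smul_mem _ _ (Submodule.subset_span
    ⟨⟨i, Finset.mem_range.1 hi⟩, rfl⟩)

theorem cyclicVec_eq_wedge (hn : ∀ x : Cell n m, x.2.val < 2 * n) :
    cyclicVec K n m = wedge K fun x => ⟨x.2.val, hn x⟩ := by
  rw [cyclicVec, wedge]
  congr 1
  funext s
  rw [hwVec]
  congr 1
  funext i j
  simp [Pi.single_apply, Fin.ext_iff]

theorem wedge_swap (w : Cell n m → Fin (2 * n)) (s : Slot n m) (i j : Fin s.deg) (h : i ≠ j) :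
    wedge K (w ∘ Equiv.swap ⟨s, i⟩ ⟨s, j⟩) = -wedge K w := by
  have h1 := (exteriorPower.ιMulti K s.deg).map_swap
    (fun i => (Pi.single (w ⟨s, i⟩) (1 : K) : Fin (2 * n) → K)) h
  rw [eq_neg_iff_add_eq_zero, wedge, wedge]
  have h2 : (fun s' => exteriorPower.ιMulti K s'.deg fun l =>
      (Pi.single ((w ∘ Equiv.swap (⟨s, i⟩ : Cell n m) ⟨s, j⟩) ⟨s', l⟩) (1 : K) : Fin (2 * n) → K)) =
      Function.update (fun s' => exteriorPower.ιMulti K s'.deg fun l =>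
        (Pi.single (w ⟨s', l⟩) (1 : K) : Fin (2 * n) → K)) s
        (-exteriorPower.ιMulti K s.deg fun l => Pi.single (w ⟨s, l⟩) (1 : K)) := by
    funext s'
    by_cases hs : s' = s
    · subst hs
      rw [Function.update_self, ← h1]
      congr 1
      funext l
      simp only [Function.comp_apply]
      congr 2
      by_cases hi : l = i
      · subst hi; simp
      · by_cases hj : l = j
        · subst hj; simp
        · rw [Equiv.swap_apply_of_ne_of_ne hi hj, Equiv.swap_apply_of_ne_of_ne] <;> simpa
    · rw [Function.update_of_ne hs]
      congr 1
      funext l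
      rw [Function.comp_apply, Equiv.swap_apply_of_ne_of_ne] <;>
        exact fun h' => hs (congrArg Sigma.fst h')
  rw [h2, MultilinearMap.map_update_neg, Function.update_eq_self, neg_add_cancel]

theorem wedge_eq_zero (w : Cell n m → Fin (2 * n)) (s : Slot n m) (i j : Fin s.deg) (h : i ≠ j)
    (hw : w ⟨s, i⟩ = w ⟨s, j⟩) : wedge K w = 0 := by
  refine (PiTensorProduct.tprod K).map_coord_zero s ?_
  refine AlternatingMap.map_eq_zero_of_eq _ _ (i := i) (j := j) ?_ h
  simp only [hw]

/-! ### The basis of decreasing wedges and the weight spaces -/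

/-- The wedge products in every factor are those of strictly decreasing sequences. -/
def IsAnti (w : Cell n m → Fin (2 * n)) : Prop := ∀ s, StrictAnti fun i => w ⟨s, i⟩

/-- A family of strictly decreasing sequences as a family of order embeddings. -/
def antiEquiv (n : ℕ) (m : Fin (n - 1) → ℕ) : (∀ s : Slot n m, Fin s.deg ↪o (Fin (2 * n))ᵒᵈ) ≃
    {w : Cell n m → Fin (2 * n) // IsAnti w} where
  toFun φ := ⟨fun x => OrderDual.ofDual (φ x.1 x.2), fun s _ _ h => (φ s).strictMono h⟩
  invFun w s := OrderEmbedding.ofStrictMono (fun i => OrderDual.toDual (w.val ⟨s, i⟩))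
    fun _ _ h => w.prop s h
  left_inv _ := rfl
  right_inv _ := rfl

theorem exists_wedge_basis : ∃ b : Module.Basis {w : Cell n m → Fin (2 * n) // IsAnti w} K
    (TensorSpace K n m), ∀ w, b w = wedge K w.val := by
  -- The standard basis of an exterior power uses increasing sequences. Reversing the order of the
  -- index set makes them decreasing.
  let b₀ := (Pi.basisFun K (Fin (2 * n))).reindex OrderDual.toDual
  let b₁ : ∀ s : Slot n m, Module.Basis _ K (Fund K (2 * n) s.deg) := fun s =>
    (b₀.exteriorPower s.deg).reindex Set.powersetCard.ofFinEmbEquiv.symm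
  refine ⟨(Basis.piTensorProduct b₁).reindex (antiEquiv n m), fun w => ?_⟩
  rw [Module.Basis.reindex_apply, Basis.piTensorProduct_apply, wedge]
  congr 1
  funext s
  simp only [b₁, Module.Basis.reindex_apply, exteriorPower.basis_apply,
    exteriorPower.ιMulti_family]
  congr 1
  funext i
  simp only [b₀, Equiv.symm_symm, Equiv.symm_apply_apply, Function.comp_apply,
    Module.Basis.reindex_apply, OrderDual.toDual_symm_eq, Pi.basisFun_apply]
  rfl

theorem glTensorRep_one : glTensorRep K n m 1 =
    algebraMap K (Module.End K (TensorSpace K n m)) ((∑ s : Slot n m, s.deg : ℕ) : K) := by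
  refine LinearMap.ext fun x => ?_
  obtain ⟨b, hb⟩ := exists_wedge_basis (K := K) (n := n) (m := m)
  revert x
  rw [← LinearMap.ext_iff]
  refine b.ext fun w => ?_
  have h : (1 : Matrix (Fin (2 * n)) (Fin (2 * n)) K) = ∑ j, Matrix.single j j 1 := by
    rw [Matrix.sum_single_one]
  rw [hb, h, map_sum, LinearMap.sum_apply]
  simp only [glTensorRep_diag_wedge]
  rw [← Finset.sum_smul, Module.algebraMap_end_apply, ← Nat.cast_sum]
  congr 2
  rw [← Finset.card_eq_sum_card_fiberwise (f := w.val) (s := Finset.univ) (t := Finset.univ)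
    (by simp)]
  simp [Finset.card_univ, Fintype.card_sigma]

/-- The number of entries `j` of a family of sequences. -/
def content (w : Cell n m → Fin (2 * n)) (j : Fin (2 * n)) : ℕ :=
  (Finset.univ.filter fun x => w x = j).card

theorem wedge_mem_weightSpace (w : Cell n m → Fin (2 * n)) (μ : Fin (2 * n) → ℕ)
    (h : ∀ j, content w j = μ j) : wedge K w ∈ weightSpace K n m μ := by
  rw [weightSpace, Submodule.mem_iInf]
  intro j
  rw [Module.End.mem_eigenspace_iff, glTensorRep_diag_wedge, ← h j, content]

/-- Each `E_jj` is diagonal in the wedge basis with eigenvalue the number of entries `j`. In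
characteristic zero distinct numbers stay distinct, so only wedges of the right content can have
nonzero coordinates. -/
theorem weightSpace_eq_span [CharZero K] (μ : Fin (2 * n) → ℕ) :
    weightSpace K n m μ = Submodule.span K (Set.range
      fun w : {w : Cell n m → Fin (2 * n) // IsAnti w ∧ ∀ j, content w j = μ j} =>
        wedge K w.val) := by
  classical
  refine le_antisymm (fun x hx => ?_) (Submodule.span_le.2 ?_)
  · obtain ⟨b, hb⟩ := exists_wedge_basis (K := K) (n := n) (m := m)
    rw [weightSpace, Submodule.mem_iInf] at hx
    rw [← b.sum_repr x]
    refine Submodule.sum_mem _ fun w _ => ?_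
    by_cases hw : ∀ j, content w.val j = μ j
    · refine Submodule.smul_mem _ _ (Submodule.subset_span ⟨⟨w.val, w.prop, hw⟩, ?_⟩)
      rw [hb]
    · rw [not_forall] at hw
      obtain ⟨j, hj⟩ := hw
      have h1 := Module.End.mem_eigenspace_iff.1 (hx j)
      have h2 : (content w.val j : K) * b.repr x w = μ j * b.repr x w := by
        have h3 := congrArg (fun y => b.repr y w) h1
        simp only [map_smul, Finsupp.smul_apply, smul_eq_mul] at h3
        rw [← h3]
        nth_rewrite 2 [← b.sum_repr x]
        rw [map_sum, map_sum]
        simp only [map_smul, hb, glTensorRep_diag_wedge]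
        simp only [← hb, b.repr_self, Finsupp.finsetSum_apply, Finsupp.smul_apply,
          Finsupp.single_apply]
        simp [content, mul_comm]
      have h3 : b.repr x w = 0 := by
        by_contra h
        exact hj (by exact_mod_cast mul_right_cancel₀ h h2)
      rw [h3, zero_smul]
      exact Submodule.zero_mem _
  · rintro _ ⟨w, rfl⟩
    exact wedge_mem_weightSpace _ _ w.prop.2

theorem linearIndependent_wedge (μ : Fin (2 * n) → ℕ) : LinearIndependent K
      fun w : {w : Cell n m → Fin (2 * n) // IsAnti w ∧ ∀ j, content w j = μ j} =>
        wedge K w.val := by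
  obtain ⟨b, hb⟩ := exists_wedge_basis (K := K) (n := n) (m := m)
  have h := b.linearIndependent.comp
    (fun w : {w : Cell n m → Fin (2 * n) // IsAnti w ∧ ∀ j, content w j = μ j} =>
      (⟨w.val, w.prop.1⟩ : {w : Cell n m → Fin (2 * n) // IsAnti w}))
    fun w w' h => Subtype.ext (Subtype.mk.inj h)
  have h' : (fun w : {w : Cell n m → Fin (2 * n) // IsAnti w ∧ ∀ j, content w j = μ j} =>
      wedge K w.val) = b ∘ fun w => ⟨w.val, w.prop.1⟩ := funext fun w => (hb ⟨w.val, w.prop.1⟩).symm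
  rw [h']
  exact h

theorem evalTensorRep_one_tmul (ζ : Slot n m → K) (h : slN K (2 * n)) :
    evalTensorRep K n m ζ ((1 : K[X]) ⊗ₜ[K] h) = glTensorRep K n m h.val := by
  change (∑ s, PiTensorProduct.map (Pi.mulSingle s (fundRep K (2 * n) s.deg
    (evalLin (ζ s) _)) : ∀ s : Slot n m, Module.End K (Fund K (2 * n) s.deg))) = _
  simp only [evalLin_tmul, Polynomial.eval_one, one_smul]
  rfl

theorem glTensorRep_eq_sum_of_isDiag {h : Matrix (Fin (2 * n)) (Fin (2 * n)) K} (hd : h.IsDiag) :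
    glTensorRep K n m h = ∑ j, h j j • glTensorRep K n m (Matrix.single j j 1) := by
  have : h = ∑ j, h j j • Matrix.single j j 1 := by
    conv_lhs => rw [← hd.diagonal_diag, ← Matrix.sum_single_eq_diagonal]
    simp [Matrix.smul_single]
  conv_lhs => rw [this]
  simp only [map_sum, map_smul]

/-- `E_jj` differs from a traceless matrix by a multiple of the identity, which acts by the total
degree. The hypothesis `hμ` makes this scalar equal to `∑ j, μ j`, as the weight requires. -/
theorem slWeightSpace_eq_weightSpace [CharZero K] (ζ : Slot n m → K) (μ : Fin (2 * n) → ℕ)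
    (hμ : ∑ j, μ j = ∑ s : Slot n m, s.deg) :
    slWeightSpace K n m ζ μ = weightSpace K n m μ := by
  refine le_antisymm (fun x hx => ?_) (fun x hx => ?_)
  · rw [slWeightSpace, Submodule.mem_iInf] at hx
    rw [weightSpace, Submodule.mem_iInf]
    intro j
    have hn : ((2 * n : ℕ) : K) ≠ 0 := by
      have := j.isLt
      exact_mod_cast (by omega : 2 * n ≠ 0)
    let h₀ : Matrix (Fin (2 * n)) (Fin (2 * n)) K := Matrix.single j j 1 - ((2 * n : ℕ) : K)⁻¹ • 1
    have htr : h₀.trace = 0 := by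
      simp only [h₀, Matrix.trace_sub, Matrix.trace_smul, Matrix.trace_one, Fintype.card_fin,
        Matrix.trace_single_eq_same, smul_eq_mul]
      rw [inv_mul_cancel₀ hn, sub_self]
    have hd : h₀.IsDiag := by
      intro a b hab
      have : Matrix.single j j (1 : K) a b = 0 := by
        rw [Matrix.single_apply, if_neg]
        rintro ⟨rfl, rfl⟩
        exact hab rfl
      simp [h₀, this, Matrix.one_apply_ne hab]
    have h1 := hx ⟨⟨h₀, htr⟩, hd⟩
    rw [Module.End.mem_eigenspace_iff, evalTensorRep_one_tmul] at h1
    simp only at h1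
    rw [map_sub, map_smul, glTensorRep_one, LinearMap.sub_apply, LinearMap.smul_apply,
      Module.algebraMap_end_apply, sub_eq_iff_eq_add] at h1
    rw [Module.End.mem_eigenspace_iff, h1, smul_smul, ← add_smul]
    congr 1
    simp only [h₀, Matrix.sub_apply, Matrix.smul_apply, Matrix.one_apply_eq, smul_eq_mul, mul_one,
      mul_sub, Finset.sum_sub_distrib, Matrix.single_apply, ← hμ, and_self, mul_ite, mul_zero,
      Finset.sum_ite_eq, Finset.mem_univ, if_true, Nat.cast_sum, ← Finset.sum_mul]
    ring
  · rw [weightSpace, Submodule.mem_iInf] at hx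
    rw [slWeightSpace, Submodule.mem_iInf]
    intro h
    rw [Module.End.mem_eigenspace_iff, evalTensorRep_one_tmul,
      glTensorRep_eq_sum_of_isDiag h.prop, LinearMap.sum_apply, Finset.sum_smul]
    refine Finset.sum_congr rfl fun j _ => ?_
    rw [LinearMap.smul_apply, Module.End.mem_eigenspace_iff.1 (hx j), smul_smul]
    congr 1
    exact mul_comm _ _

/-! ### Products of lowering operators on the cyclic vector -/

theorem Slot.deg_lt (s : Slot n m) : s.deg < n := by
  have := s.1.isLt
  rw [Slot.deg]
  omega

theorem Cell.val_lt (x : Cell n m) : x.2.val < n := x.2.isLt.trans x.1.deg_lt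

/-- The position of a cell as an index of a basis vector. -/
def Cell.pos (x : Cell n m) : Fin (2 * n) := ⟨x.2.val, by have := x.val_lt; omega⟩

theorem Cell.pos_lt (x : Cell n m) : x.pos.val < n := x.val_lt

theorem Cell.ext_pos {x y : Cell n m} (h : x.1 = y.1) (h' : x.pos = y.pos) : x = y := by
  obtain ⟨s, i⟩ := x
  obtain ⟨t, j⟩ := y
  obtain rfl : s = t := h
  have hij : i = j := Fin.ext (congrArg Fin.val h' :)
  rw [hij]

/-- The number of cells at position `a.1` with entry `a.2`. -/
def cellCount (w : Cell n m → Fin (2 * n)) (a : Fin (2 * n) × Fin (2 * n)) : ℕ :=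
  (Finset.univ.filter fun x : Cell n m => x.pos = a.1 ∧ w x = a.2).card

/-- The families obtained from the family of positions by replacing, for each `(p, q)` in the list
`L`, an entry `p` at a position `p` by `q`. -/
def Matches (w : Cell n m → Fin (2 * n)) (L : List (Fin (2 * n) × Fin (2 * n))) : Prop :=
  (∀ x, w x = x.pos ∨ n ≤ (w x).val) ∧ ∀ a, n ≤ a.2.val → cellCount w a = L.count a

theorem cellCount_update (w : Cell n m → Fin (2 * n)) (x : Cell n m) (q : Fin (2 * n))
    (hx : (w x).val < n) (b : Fin (2 * n) × Fin (2 * n)) (hb : n ≤ b.2.val) :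
    cellCount (Function.update w x q) b = cellCount w b + if (x.pos, q) = b then 1 else 0 := by
  -- The overwritten entry is small, so no count of a large entry decreases.
  have hxb : w x ≠ b.2 := fun h => by rw [h] at hx; omega
  split_ifs with h
  · subst h
    rw [cellCount, cellCount, ← Finset.card_insert_of_notMem (a := x)]
    · congr 1
      ext y
      by_cases hy : y = x
      · subst hy; simp
      · simp [hy]
    · simp only [Finset.mem_filter, not_and]
      exact fun _ _ => hxb
  · rw [add_zero, cellCount, cellCount]
    congr 1
    ext y
    by_cases hy : y = x
    · subst hy
      simp only [Finset.mem_filter, Finset.mem_univ, true_and, Function.update_self, hxb, and_false,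
        iff_false, not_and]
      exact fun h1 h2 => h (Prod.ext h1 h2)
    · simp [hy]

theorem matches_update_iff (w : Cell n m → Fin (2 * n)) (L : List (Fin (2 * n) × Fin (2 * n)))
    (x : Cell n m) (hx : w x = x.pos) (q : Fin (2 * n)) (hq : n ≤ q.val) :
    Matches (Function.update w x q) ((x.pos, q) :: L) ↔ Matches w L := by
  refine and_congr (forall_congr' fun y => ?_) (forall_congr' fun a => imp_congr_right fun ha => ?_)
  · by_cases hy : y = x
    · subst hy; simp [hq, hx]
    · simp [hy]
  · rw [cellCount_update w x q (hx ▸ x.pos_lt) a ha, List.count_cons]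
    simp only [beq_iff_eq]
    omega

theorem matches_nil (w : Cell n m → Fin (2 * n)) : Matches w [] ↔ w = Cell.pos := by
  refine ⟨fun h => funext fun x => (h.1 x).resolve_right fun hx => ?_, ?_⟩
  · have h1 := h.2 (x.pos, w x) hx
    rw [List.count_nil, cellCount, Finset.card_eq_zero] at h1
    exact Finset.notMem_empty x (h1 ▸ by simp)
  · rintro rfl
    refine ⟨fun x => Or.inl rfl, fun a ha => ?_⟩
    rw [List.count_nil, cellCount, Finset.card_eq_zero, Finset.filter_eq_empty_iff]
    rintro x - ⟨-, h⟩
    have := x.pos_lt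
    rw [h] at this
    omega

/-- The product of the values `g_{pq}(ζ_s)` over the cells with a replaced entry. -/
def coeff (ζ : Slot n m → K) (g : Fin (2 * n) × Fin (2 * n) → K[X])
    (w : Cell n m → Fin (2 * n)) : K :=
  ∏ x with n ≤ (w x).val, (g (x.pos, w x)).eval (ζ x.1)

theorem coeff_update (ζ : Slot n m → K) (g : Fin (2 * n) × Fin (2 * n) → K[X])
    (w : Cell n m → Fin (2 * n)) (x : Cell n m) (hx : w x = x.pos) (q : Fin (2 * n))
    (hq : n ≤ q.val) :
    coeff ζ g (Function.update w x q) = coeff ζ g w * (g (x.pos, q)).eval (ζ x.1) := by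
  have hxn := x.pos_lt
  rw [← hx] at hxn
  have h : (Finset.univ.filter fun y => n ≤ (Function.update w x q y).val) =
      insert x (Finset.univ.filter fun y => n ≤ (w y).val) := by
    ext y
    by_cases hy : y = x
    · subst hy; simp [hq]
    · simp [hy]
  rw [coeff, h, Finset.prod_insert (by simpa using hxn), Function.update_self, mul_comm, coeff]
  congr 1
  refine Finset.prod_congr rfl fun y hy => ?_
  have : y ≠ x := by
    rintro rfl
    have := (Finset.mem_filter.1 hy).2
    omega
  rw [Function.update_of_ne this]

-- Count pairs of a family and a cell. Replacing `a.1` by `a.2` at a cell can be undone, so a target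
-- family is reached once for each of its cells at position `a.1` with entry `a.2`. There are
-- `L.count a + 1` of these.
open Classical in
theorem lowering_sum_matches (ζ : Slot n m → K) (g : Fin (2 * n) × Fin (2 * n) → K[X])
    (a : Fin (2 * n) × Fin (2 * n)) (ha : a.1.val < n ∧ n ≤ a.2.val)
    (L : List (Fin (2 * n) × Fin (2 * n))) :
    lowering ζ a (g a) (∑ w with Matches w L, coeff ζ g w • wedge K w) =
      ((L.count a + 1 : ℕ) : K) • ∑ w with Matches w (a :: L), coeff ζ g w • wedge K w := by
  have hne : a.1 ≠ a.2 := fun h => by rw [h] at ha; omega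
  simp only [map_sum, map_smul, lowering_wedge ζ a hne, ← Finset.sum_filter, Finset.smul_sum]
  have h : ∀ w ∈ Finset.univ.filter fun w : Cell n m → Fin (2 * n) => Matches w (a :: L),
      ((L.count a + 1 : ℕ) : K) • coeff ζ g w • wedge K w =
        ∑ x with x.pos = a.1 ∧ w x = a.2, coeff ζ g w • wedge K w := by
    intro w hw
    rw [Finset.sum_const, Nat.cast_smul_eq_nsmul]
    congr 1
    have := (Finset.mem_filter.1 hw).2.2 a ha.2
    rw [cellCount, List.count_cons_self] at this
    exact this.symm
  rw [Finset.sum_congr rfl h, Finset.sum_sigma', Finset.sum_sigma']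
  have hpos : ∀ w : Cell n m → Fin (2 * n), Matches w L → ∀ x, w x = a.1 → x.pos = a.1 := by
    intro w hw x hx
    refine ((hw.1 x).resolve_right fun h => ?_).symm.trans hx
    rw [hx] at h
    omega
  refine Finset.sum_bij' (fun y _ => ⟨Function.update y.1 y.2 a.2, y.2⟩)
    (fun y _ => ⟨Function.update y.1 y.2 a.1, y.2⟩) ?_ ?_ ?_ ?_ ?_
  · rintro ⟨w, x⟩ hy
    simp only [Finset.mem_sigma, Finset.mem_filter, Finset.mem_univ, true_and] at hy ⊢
    have hp := hpos w hy.1 x hy.2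
    refine ⟨?_, hp, Function.update_self _ _ _⟩
    have := (matches_update_iff w L x (hy.2.trans hp.symm) a.2 ha.2).2 hy.1
    rwa [hp] at this
  · rintro ⟨w, x⟩ hy
    simp only [Finset.mem_sigma, Finset.mem_filter, Finset.mem_univ, true_and] at hy ⊢
    refine ⟨?_, Function.update_self _ _ _⟩
    rw [← matches_update_iff _ L x (by rw [Function.update_self, hy.2.1]) a.2 ha.2, hy.2.1,
      Function.update_idem, ← hy.2.2, Function.update_eq_self, hy.2.2]
    exact hy.1
  · rintro ⟨w, x⟩ hy
    simp only [Finset.mem_sigma, Finset.mem_filter, Finset.mem_univ, true_and] at hy ⊢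
    rw [Function.update_idem, ← hy.2, Function.update_eq_self]
  · rintro ⟨w, x⟩ hy
    simp only [Finset.mem_sigma, Finset.mem_filter, Finset.mem_univ, true_and] at hy ⊢
    rw [Function.update_idem, ← hy.2.2, Function.update_eq_self]
  · rintro ⟨w, x⟩ hy
    simp only [Finset.mem_sigma, Finset.mem_filter, Finset.mem_univ, true_and] at hy ⊢
    have hp := hpos w hy.1 x hy.2
    rw [coeff_update ζ g w x (hy.2.trans hp.symm) a.2 ha.2, smul_smul, hp]

theorem cyclicVec_eq : cyclicVec K n m = wedge K Cell.pos := cyclicVec_eq_wedge _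

-- The constant collects the factors `L.count a + 1` and is nonzero in characteristic zero. All
-- occurrences of a pair carry the same polynomial, so the coefficient of a family depends only on
-- where its entries lie.
open Classical in
theorem prod_lowering_cyclicVec [CharZero K] (ζ : Slot n m → K)
    (g : Fin (2 * n) × Fin (2 * n) → K[X]) (L : List (Fin (2 * n) × Fin (2 * n)))
    (hL : ∀ a ∈ L, a.1.val < n ∧ n ≤ a.2.val) :
    ∃ c : K, c ≠ 0 ∧ (L.map fun a => lowering ζ a (g a)).prod (cyclicVec K n m) =
      c • ∑ w with Matches w L, coeff ζ g w • wedge K w := by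
  induction L with
  | nil =>
    refine ⟨1, one_ne_zero, ?_⟩
    have : (Finset.univ.filter fun w : Cell n m → Fin (2 * n) => Matches w []) = {Cell.pos} := by
      ext w
      simp [matches_nil]
    rw [this, Finset.sum_singleton, one_smul, coeff, Finset.filter_false_of_mem, Finset.prod_empty,
      one_smul, cyclicVec_eq]
    · rfl
    · intro x _
      have := x.pos_lt
      omega
  | cons a L ih =>
    obtain ⟨c, hc, h⟩ := ih fun b hb => hL b (List.mem_cons_of_mem _ hb)
    refine ⟨c * ((L.count a + 1 : ℕ) : K), mul_ne_zero hc (Nat.cast_ne_zero.2 (Nat.succ_ne_zero _)), ?_⟩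
    rw [List.map_cons, List.prod_cons, Module.End.mul_apply, h, map_smul,
      lowering_sum_matches ζ g a (hL a List.mem_cons_self), smul_smul]

/-- The product of the elements `f_{pq} ⊗ t^d` for the entries `((p, q), d)` of a list. -/
def monomial (ζ : Slot n m → K) (l : List ((Fin (2 * n) × Fin (2 * n)) × ℕ)) :
    Module.End K (TensorSpace K n m) :=
  (l.map fun y => lowering ζ y.1 (Polynomial.X ^ y.2)).prod

/-- Here equal pairs may carry different exponents. Only the support is tracked, which is enough to
determine the weight. -/
theorem monomial_cyclicVec_mem (ζ : Slot n m → K) (l : List ((Fin (2 * n) × Fin (2 * n)) × ℕ))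
    (hl : ∀ y ∈ l, y.1.1.val < n ∧ n ≤ y.1.2.val) :
    monomial ζ l (cyclicVec K n m) ∈ Submodule.span K
      (wedge K '' {w : Cell n m → Fin (2 * n) | Matches w (l.map Prod.fst)}) := by
  induction l with
  | nil =>
    refine Submodule.subset_span ⟨Cell.pos, (matches_nil _).2 rfl, ?_⟩
    rw [← cyclicVec_eq]
    rfl
  | cons a l ih =>
    have ha := hl a List.mem_cons_self
    have hne : a.1.1 ≠ a.1.2 := fun h => by rw [h] at ha; omega
    rw [show monomial ζ (a :: l) = lowering ζ a.1 (Polynomial.X ^ a.2) * monomial ζ l from rfl,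
      Module.End.mul_apply]
    refine Submodule.span_induction (p := fun y _ => lowering ζ a.1 (Polynomial.X ^ a.2) y ∈ _)
      ?_ ?_ ?_ ?_ (ih fun b hb => hl b (List.mem_cons_of_mem _ hb))
    · rintro _ ⟨w, hw, rfl⟩
      rw [lowering_wedge ζ _ hne]
      refine Submodule.sum_mem _ fun x _ => ?_
      split_ifs with hx
      · refine Submodule.smul_mem _ _ (Submodule.subset_span ⟨_, ?_, rfl⟩)
        have hp : w x = x.pos := (hw.1 x).resolve_right fun h => by rw [hx] at h; omega
        have := (matches_update_iff w _ x hp a.1.2 ha.2).2 hw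
        rwa [← hp, hx] at this
      · exact Submodule.zero_mem _
    · rw [map_zero]; exact Submodule.zero_mem _
    · intro x y _ _ hx hy
      rw [map_add]; exact Submodule.add_mem _ hx hy
    · intro c x _ hx
      rw [map_smul]; exact Submodule.smul_mem _ _ hx

theorem monomial_perm (ζ : Slot n m → K) {l l' : List ((Fin (2 * n) × Fin (2 * n)) × ℕ)}
    (h : l.Perm l') (hl : ∀ y ∈ l, y.1.1.val < n ∧ n ≤ y.1.2.val) :
    monomial ζ l = monomial ζ l' := by
  refine (h.map _).prod_eq' ?_
  rw [List.pairwise_map]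
  refine List.Pairwise.imp_of_mem (R := fun _ _ => True) ?_ (List.pairwise_of_forall fun _ _ => trivial)
  intro a b ha hb _
  have h1 := hl a ha
  have h2 := hl b hb
  refine lowering_commute ζ _ _ ?_ ?_ ?_ ?_ _ _ <;> intro h <;> rw [Fin.ext_iff] at h <;> omega

/-- Multilinear expansion of the polynomials into powers of `t`. The degree bounds are kept because
they decide which monomials are some `Π(B)`. -/
theorem prod_lowering_mem_span (ζ : Slot n m → K) (g : Fin (2 * n) × Fin (2 * n) → K[X])
    (L : List (Fin (2 * n) × Fin (2 * n))) :
    (L.map fun a => lowering ζ a (g a)).prod ∈ Submodule.span K (monomial ζ ''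
      {l | l.map Prod.fst = L ∧ ∀ y ∈ l, y.2 ≤ (g y.1).natDegree}) := by
  induction L with
  | nil => exact Submodule.subset_span ⟨[], by simp, rfl⟩
  | cons a L ih =>
    rw [List.map_cons, List.prod_cons]
    have h := Submodule.mul_mem_mul (lowering_linear ζ a (g a) _ le_rfl) ih
    rw [Submodule.span_mul_span] at h
    refine Submodule.span_mono ?_ h
    rintro _ ⟨_, ⟨i, rfl⟩, _, ⟨l, hl, rfl⟩, rfl⟩
    refine ⟨(a, i.val) :: l, ⟨by simp [hl.1], ?_⟩, rfl⟩
    intro y hy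
    rcases List.mem_cons.1 hy with rfl | hy
    · exact Nat.lt_succ_iff.1 i.isLt
    · exact hl.2 y hy

/-- The factors of `Π(B)`. -/
def factors (B : Coll n m) : List ((Fin (2 * n) × Fin (2 * n)) × ℕ) :=
  (pairsDesc (2 * n)).flatMap fun pq =>
    ((slotList n m).filter fun s => pq ∈ B s).map fun s => (pq, tDeg B pq s)

theorem fVec_eq (ζ : Slot n m → K) (B : Coll n m) :
    fVec K ζ B = monomial ζ (factors B) (cyclicVec K n m) := by
  rw [fVec, piElt, map_list_prod, monomial, factors, List.map_flatMap, List.flatMap_def,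
    List.prod_flatten, List.map_map, List.map_map]
  congr 3
  funext pq
  simp only [Function.comp_apply, map_list_prod, List.map_map]
  congr 1
  refine List.map_congr_left fun s _ => ?_
  simp only [Function.comp_apply, UniversalEnvelopingAlgebra.lift_ι_apply]
  rfl

/-! ### Subsets of an ordered set with prescribed gap numbers -/

/-- Every multiset of `c` numbers that are at most `#A - c` is the multiset of the numbers of
elements of `A \ C` below the elements of `C`, for a subset `C` of the totally ordered set `A`. -/
theorem exists_subset_map_card_lt {ι α : Type*} [DecidableEq ι] [LinearOrder α] (key : ι → α)
    (A : Finset ι) (hinj : Set.InjOn key A) (e : Multiset ℕ)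
    (he : ∀ x ∈ e, x + e.card ≤ A.card) :
    ∃ C ⊆ A, C.val.map (fun s => ((A \ C).filter fun s' => key s' < key s).card) = e := by
  induction A using Finset.induction_on_max_value key generalizing e with
  | empty =>
    refine ⟨∅, subset_rfl, ?_⟩
    rcases e.empty_or_exists_mem with rfl | ⟨x, hx⟩
    · rfl
    · have h1 := he x hx
      have h2 := Multiset.card_pos_iff_exists_mem.2 ⟨x, hx⟩
      rw [Finset.card_empty] at h1
      omega
  | insert a A ha hmax ih =>
    rw [Finset.card_insert_of_notMem ha] at he
    have hA : Set.InjOn key A := hinj.mono (by simp)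
    -- The maximum `a` must be chosen exactly when `e` contains the largest permitted value, since
    -- then the whole complement lies below `a`. If `a` is not chosen, it lies above every chosen
    -- element and contributes to no gap.
    by_cases h : ∃ x ∈ e, x + e.card = A.card + 1
    · obtain ⟨x, hx, hxe⟩ := h
      obtain ⟨e, rfl⟩ := Multiset.exists_cons_of_mem hx
      rw [Multiset.card_cons] at he hxe
      obtain ⟨C, hC, hCe⟩ := ih hA e fun y hy => by
        have := he y (Multiset.mem_cons_of_mem hy)
        omega
      have haC : a ∉ C := fun h => ha (hC h)
      have hd : insert a A \ insert a C = A \ C := by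
        ext y
        simp only [Finset.mem_sdiff, Finset.mem_insert, not_or]
        constructor
        · rintro ⟨h1 | h1, h2, h3⟩
          · exact absurd h1 h2
          · exact ⟨h1, h3⟩
        · rintro ⟨h1, h3⟩
          exact ⟨Or.inr h1, fun h => ha (h ▸ h1), h3⟩
      refine ⟨insert a C, Finset.insert_subset_insert a hC, ?_⟩
      rw [hd, Finset.insert_val_of_notMem haC, Multiset.map_cons, hCe]
      congr 1
      have hcard : e.card = C.card := by rw [← hCe, Multiset.card_map]; rfl
      rw [Finset.filter_true_of_mem, Finset.card_sdiff_of_subset hC]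
      · omega
      · intro y hy
        have hyA := (Finset.mem_sdiff.1 hy).1
        refine lt_of_le_of_ne (hmax y hyA) fun h => ?_
        have := hinj (by simp [hyA]) (by simp) h
        exact ha (this ▸ hyA)
    · obtain ⟨C, hC, hCe⟩ := ih hA e fun y hy => by
        have h1 := he y hy
        have h2 : y + e.card ≠ A.card + 1 := fun h' => h ⟨y, hy, h'⟩
        omega
      refine ⟨C, hC.trans (Finset.subset_insert a A), ?_⟩
      rw [← hCe]
      refine Multiset.map_congr rfl fun s hs => ?_
      congr 1
      ext y
      simp only [Finset.mem_filter, Finset.mem_sdiff, Finset.mem_insert]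
      constructor
      · rintro ⟨⟨rfl | h1, h2⟩, h3⟩
        · exact absurd h3 (hmax s (hC hs)).not_gt
        · exact ⟨⟨h1, h2⟩, h3⟩
      · rintro ⟨⟨h1, h2⟩, h3⟩
        exact ⟨⟨Or.inr h1, h2⟩, h3⟩

/-! ### Columns with prescribed gap numbers -/

section Columns

variable {ι : Type*}

/-- Columns of lengths `d` with positive entries at most `N`, decreasing as far as they are less
than `N`, and extended by zero. -/
structure IsColumns (d : ι → ℕ) (N : ℕ) (w : ι → ℕ → ℕ) : Prop where
  zero : ∀ s p, d s ≤ p → w s p = 0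
  pos : ∀ s p, p < d s → 0 < w s p
  anti : ∀ s p, p < d s → w s p < N → w s (p + 1) < w s p

variable {d : ι → ℕ} {N : ℕ} {w w' : ι → ℕ → ℕ}

theorem IsColumns.lt_of_pos (hw : IsColumns d N w) {s : ι} {p : ℕ} (h : 0 < w s p) : p < d s := by
  by_contra h'
  rw [hw.zero s p (not_lt.1 h')] at h
  exact h.false

theorem IsColumns.succ_lt (hw : IsColumns d N w) {s : ι} {p q : ℕ} (hq : q ≤ N) (h : w s p < q) :
    w s (p + 1) < q := by
  by_cases hp : p < d s
  · exact (hw.anti s p hp (h.trans_le hq)).trans h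
  · rw [hw.zero s (p + 1) (by omega)]
    omega

theorem IsColumns.lt_of_le (hw : IsColumns d N w) {s : ι} {p p' q : ℕ} (hq : q ≤ N)
    (h : w s p < q) (hp : p ≤ p') : w s p' < q := by
  induction p', hp using Nat.le_induction with
  | base => exact h
  | succ k _ ih => exact hw.succ_lt hq ih

theorem IsColumns.anti_of_lt (hw : IsColumns d N w) {s : ι} {p p' : ℕ} (hp : p < p')
    (hd : p < d s) (hN : w s p < N) : w s p' < w s p :=
  hw.lt_of_le hN.le (hw.anti s p hd hN) hp

variable [Fintype ι]

/-- The indices whose column has an entry at least `q` at position `p` and smaller entries at the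
later positions. -/
def ready (w : ι → ℕ → ℕ) (p q : ℕ) : Finset ι :=
  Finset.univ.filter fun s => w s (p + 1) < q ∧ q ≤ w s p

/-- The indices whose column has the entry `q` at position `p`. -/
def placed (w : ι → ℕ → ℕ) (p q : ℕ) : Finset ι :=
  Finset.univ.filter fun s => w s p = q

@[simp]
theorem mem_ready {w : ι → ℕ → ℕ} {p q : ℕ} {s : ι} :
    s ∈ ready w p q ↔ w s (p + 1) < q ∧ q ≤ w s p := by simp [ready]

@[simp]
theorem mem_placed {w : ι → ℕ → ℕ} {p q : ℕ} {s : ι} : s ∈ placed w p q ↔ w s p = q := by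
  simp [placed]

theorem IsColumns.placed_subset_ready (hw : IsColumns d N w) {p q : ℕ} (h0 : 0 < q) (hq : q < N) :
    placed w p q ⊆ ready w p q := by
  intro s hs
  rw [mem_placed] at hs
  rw [mem_ready]
  refine ⟨?_, hs.ge⟩
  rw [← hs]
  exact hw.anti s p (hw.lt_of_pos (by omega)) (by omega)

theorem IsColumns.placed_zero (hw : IsColumns d N w) (p : ℕ) :
    placed w p 0 = Finset.univ.filter fun s => d s ≤ p := by
  ext s
  rw [mem_placed, Finset.mem_filter]
  refine ⟨fun h => ⟨Finset.mem_univ _, ?_⟩, fun h => hw.zero s p h.2⟩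
  by_contra h'
  have := hw.pos s p (not_le.1 h')
  omega

theorem card_filter_lt_eq_sum (w : ι → ℕ → ℕ) (p q : ℕ) :
    (Finset.univ.filter fun s => w s p < q).card = ∑ j ∈ Finset.range q, (placed w p j).card := by
  rw [Finset.card_eq_sum_card_fiberwise (f := fun s => w s p) (t := Finset.range q)]
  · refine Finset.sum_congr rfl fun j hj => ?_
    congr 1
    ext s
    simp only [Finset.mem_filter, Finset.mem_univ, true_and, mem_placed]
    have := Finset.mem_range.1 hj
    omega
  · intro s hs
    simpa using hs

/-- An entry below `q` at `p` forces one at `p + 1`. So the columns with an entry below `q` at `p +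
1` split into the ready ones and those already below `q` at `p`. -/
theorem IsColumns.card_ready_add (hw : IsColumns d N w) {p q : ℕ} (hq : q ≤ N) :
    (ready w p q).card + ∑ j ∈ Finset.range q, (placed w p j).card =
      ∑ j ∈ Finset.range q, (placed w (p + 1) j).card := by
  classical
  rw [← card_filter_lt_eq_sum, ← card_filter_lt_eq_sum, ← Finset.card_union_of_disjoint]
  · congr 1
    ext s
    simp only [Finset.mem_union, mem_ready, Finset.mem_filter, Finset.mem_univ, true_and]
    constructor
    · rintro (h | h)
      · exact h.1
      · exact hw.succ_lt hq h
    · intro h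
      by_cases h' : w s p < q
      · exact Or.inr h'
      · exact Or.inl ⟨h, not_lt.1 h'⟩
  · rw [Finset.disjoint_left]
    intro s hs hs'
    have h1 := (mem_ready.1 hs).2
    have h2 := (Finset.mem_filter.1 hs').2
    omega

/-- The number of ready columns is a function of the numbers of entries below `q`. A bound on
exponents proved for one family therefore holds for every family with these counts. -/
theorem IsColumns.card_ready_eq (hw : IsColumns d N w) (hw' : IsColumns d N w') {p q : ℕ}
    (hq : q ≤ N) (h : ∀ j, 0 < j → j < q → ∀ p, (placed w p j).card = (placed w' p j).card) :
    (ready w p q).card = (ready w' p q).card := by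
  have h' : ∀ p, ∑ j ∈ Finset.range q, (placed w p j).card =
      ∑ j ∈ Finset.range q, (placed w' p j).card := by
    intro p
    refine Finset.sum_congr rfl fun j hj => ?_
    rcases j.eq_zero_or_pos with rfl | hj0
    · rw [hw.placed_zero, hw'.placed_zero]
    · exact h j hj0 (Finset.mem_range.1 hj) p
  have h1 := hw.card_ready_add (p := p) hq
  have h2 := hw'.card_ready_add (p := p) hq
  rw [h', h'] at h1
  omega

/-- The entries below `N` at position `p` are as numerous as in `w'`, where they fill all columns,
so no value at least `N` is left. -/
theorem IsColumns.lt_of_card_placed (hw : IsColumns d N w) (hw' : IsColumns d N w')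
    (hN : ∀ s p, w' s p < N) (h : ∀ j, 0 < j → j < N → ∀ p,
      (placed w p j).card = (placed w' p j).card) (s : ι) (p : ℕ) : w s p < N := by
  have h' : ∑ j ∈ Finset.range N, (placed w p j).card =
      ∑ j ∈ Finset.range N, (placed w' p j).card := by
    refine Finset.sum_congr rfl fun j hj => ?_
    rcases j.eq_zero_or_pos with rfl | hj0
    · rw [hw.placed_zero, hw'.placed_zero]
    · exact h j hj0 (Finset.mem_range.1 hj) p
  rw [← card_filter_lt_eq_sum, ← card_filter_lt_eq_sum,
    Finset.filter_true_of_mem (p := fun s => w' s p < N) (fun s _ => hN s p)] at h'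
  exact (Finset.card_filter_eq_iff.1 h') s (Finset.mem_univ s)

/-- Columns with the same numbers of entries as `w'` are equal to `w'` if they do not place an entry
`q` at an index that is ready for `q` in `w'` and does not have it there. -/
theorem IsColumns.eq_of_placed [DecidableEq ι] (hw : IsColumns d N w) (hw' : IsColumns d N w')
    (hN : ∀ s p, w' s p < N)
    (h : ∀ j, 0 < j → j < N → ∀ p, (placed w p j).card = (placed w' p j).card)
    (hp : ∀ j, 0 < j → j < N → ∀ p, ∀ s ∈ placed w p j, s ∉ ready w' p j \ placed w' p j) :
    w = w' := by
  -- Strong induction on the entry: once all smaller entries agree, the ready sets for `q` agree. So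
  -- `w` places `q` only where `w'` does, and the counts force equality.
  have key : ∀ q, q < N → ∀ p, placed w p q = placed w' p q := by
    intro q
    induction q using Nat.strong_induction_on with
    | _ q ih =>
      intro hq p
      rcases q.eq_zero_or_pos with rfl | h0
      · rw [hw.placed_zero, hw'.placed_zero]
      have hlt : ∀ s p, w s p < q ↔ w' s p < q := by
        intro s p
        constructor
        · intro h1
          have := mem_placed.1 (ih _ h1 (by omega) p ▸ mem_placed.2 rfl : s ∈ placed w' p (w s p))
          omega
        · intro h1
          have := mem_placed.1 ((ih _ h1 (by omega) p).symm ▸ mem_placed.2 rfl :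
            s ∈ placed w p (w' s p))
          omega
      refine Finset.eq_of_subset_of_card_le (fun s hs => ?_) (h q h0 hq p).ge
      by_contra hs'
      refine hp q h0 hq p s hs (Finset.mem_sdiff.2 ⟨?_, hs'⟩)
      have := mem_ready.1 (hw.placed_subset_ready h0 hq hs)
      rw [mem_ready, ← hlt, ← not_lt, ← hlt, not_lt]
      exact this
  funext s p
  exact mem_placed.1 ((key _ (hN s p) p).symm ▸ mem_placed.2 rfl : s ∈ placed w p (w' s p))

/-- For each entry `q` at position `p`, the numbers of columns that are ready for `q` and precede it
without receiving it. -/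
def gaps {α : Type*} [LinearOrder α] [DecidableEq ι] (key : (ι → ℕ → ℕ) → ℕ → ι → α)
    (w : ι → ℕ → ℕ) (p q : ℕ) (s : ι) : ℕ :=
  ((ready w p q \ placed w p q).filter fun s' => key w q s' < key w q s).card

theorem gaps_congr {α : Type*} [LinearOrder α] [DecidableEq ι]
    {key : (ι → ℕ → ℕ) → ℕ → ι → α} {q : ℕ} (hkey : key w q = key w' q)
    (hlt : ∀ s p, w s p < q ↔ w' s p < q) (p : ℕ) (hpl : placed w p q = placed w' p q) :
    gaps key w p q = gaps key w' p q := by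
  have : ready w p q = ready w' p q := by
    ext s
    rw [mem_ready, mem_ready, hlt, ← not_lt, hlt, not_lt]
  funext s
  rw [gaps, gaps, this, hpl, hkey]

/-- Entries are filled in increasing order, with `N` marking cells not filled yet. At stage `q` the
subset lemma selects, for every position, the ready columns that receive `q`. Neither the ready sets
nor the keys for `q` change when `q` is written. -/
theorem exists_columns_of_gaps {α : Type*} [LinearOrder α] [DecidableEq ι]
    (key : (ι → ℕ → ℕ) → ℕ → ι → α)
    (hcongr : ∀ w w' q, (∀ s p, w s p < q ∨ w' s p < q → w s p = w' s p) → key w q = key w' q)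
    (hinj : ∀ w, IsColumns d N w → ∀ p q, q ≤ N → Set.InjOn (key w q) (ready w p q))
    (hw' : IsColumns d N w') (hN : ∀ s p, w' s p < N) (e : ℕ → ℕ → Multiset ℕ)
    (hcard : ∀ p q, 0 < q → q < N → (e p q).card = (placed w' p q).card)
    (he : ∀ p q, 0 < q → q < N → ∀ x ∈ e p q, x + (placed w' p q).card ≤ (ready w' p q).card) :
    ∃ w, IsColumns d N w ∧ (∀ s p, w s p < N) ∧
      ∀ p q, 0 < q → q < N → (placed w p q).val.map (gaps key w p q) = e p q := by
  suffices H : ∀ j, ∃ w, IsColumns d N w ∧ (∀ s p, w s p ≤ j ∨ w s p = N) ∧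
      ∀ p q, 0 < q → q ≤ j → q < N → (placed w p q).val.map (gaps key w p q) = e p q by
    obtain ⟨w, hw, -, h⟩ := H N
    refine ⟨w, hw, hw.lt_of_card_placed hw' hN fun j h0 hj p => ?_,
      fun p q h0 hq => h p q h0 hq.le hq⟩
    rw [← hcard p j h0 hj, ← h p j h0 hj.le hj, Multiset.card_map]
    rfl
  intro j
  induction j with
  | zero =>
    -- At the start every cell holds the mark `N`, so the monotonicity condition is vacuous.
    refine ⟨fun s p => if p < d s then N else 0, ⟨fun s p h => if_neg (by omega),
      fun s p h => ?_, fun s p h h' => ?_⟩, fun s p => ?_, fun p q h0 hq => by omega⟩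
    · rw [if_pos h]
      have := hN s p
      omega
    · rw [if_pos h] at h'
      exact absurd h' (lt_irrefl _)
    · by_cases hp : p < d s
      · exact Or.inr (if_pos hp)
      · exact Or.inl (if_neg hp).le
  | succ j ih =>
    obtain ⟨w, hw, hwj, h⟩ := ih
    by_cases hj : j + 1 < N
    swap
    · refine ⟨w, hw, fun s p => (hwj s p).imp_left Nat.le_succ_of_le, fun p q h0 hq hqN => ?_⟩
      exact h p q h0 (by omega) hqN
    have hplaced : ∀ q, 0 < q → q < j + 1 → ∀ p, (placed w p q).card = (placed w' p q).card := by
      intro q h0 hq p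
      rw [← hcard p q h0 (by omega), ← h p q h0 (by omega) (by omega), Multiset.card_map]
      rfl
    have hC := fun p => exists_subset_map_card_lt (key w (j + 1)) (ready w p (j + 1))
      (hinj w hw p (j + 1) hj.le) (e p (j + 1)) (by
        rw [hcard p _ j.succ_pos hj, hw.card_ready_eq hw' hj.le hplaced]
        exact he p _ j.succ_pos hj)
    choose C hCA hCe using hC
    -- All positions are filled at once: each choice overwrites only values at least `j + 1`, so the
    -- comparisons with any bound up to `j + 1` are preserved.
    let v : ι → ℕ → ℕ := fun s p => if s ∈ C p then j + 1 else w s p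
    have hv : ∀ s p, s ∉ C p → v s p = w s p := fun s p hs => if_neg hs
    have hv' : ∀ s p, s ∈ C p → v s p = j + 1 := fun s p hs => if_pos hs
    have hCr : ∀ s p, s ∈ C p → w s (p + 1) < j + 1 ∧ j + 1 ≤ w s p := fun s p hs =>
      mem_ready.1 (hCA p hs)
    have hlt : ∀ q, q ≤ j + 1 → ∀ s p, v s p < q ↔ w s p < q := by
      intro q hq s p
      by_cases hs : s ∈ C p
      · have := hCr s p hs
        rw [hv' s p hs]
        omega
      · rw [hv s p hs]
    have hkey : ∀ q, q ≤ j + 1 → key v q = key w q := by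
      refine fun q hq => hcongr _ _ _ fun s p hsp => hv s p fun hs => ?_
      rw [hlt q hq, or_self] at hsp
      have := hCr s p hs
      omega
    refine ⟨v, ⟨fun s p hsp => ?_, fun s p hsp => ?_, fun s p hsp hN => ?_⟩, fun s p => ?_,
      fun p q h0 hq hqN => ?_⟩
    · rw [hv, hw.zero s p hsp]
      intro hs
      have := hCr s p hs
      rw [hw.zero s p hsp] at this
      omega
    · by_cases hs : s ∈ C p
      · rw [hv' s p hs]; omega
      · rw [hv s p hs]; exact hw.pos s p hsp
    · by_cases hs : s ∈ C p
      · have := hCr s p hs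
        rw [hv' s p hs, hlt _ le_rfl]
        exact this.1
      · rw [hv s p hs] at hN ⊢
        have h1 := hw.anti s p hsp hN
        have h2 : w s p ≤ j := (hwj s p).resolve_right hN.ne
        rw [hlt _ (by omega)]
        exact h1
    · by_cases hs : s ∈ C p
      · rw [hv' s p hs]; exact Or.inl le_rfl
      · rw [hv s p hs]; exact (hwj s p).imp_left Nat.le_succ_of_le
    · rcases hq.lt_or_eq with hq' | rfl
      · have hpl : placed v p q = placed w p q := by
          ext s
          rw [mem_placed, mem_placed]
          have h1 := hlt q hq s p
          have h2 := hlt (q + 1) hq' s p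
          omega
        rw [gaps_congr (hkey q hq) (hlt q hq) p hpl, hpl, h p q h0 (by omega) hqN]
      · have hpl : placed v p (j + 1) = C p := by
          ext s
          rw [mem_placed]
          by_cases hs : s ∈ C p
          · simp [hs, hv']
          · rw [hv s p hs]
            have := hwj s p
            simp only [hs, iff_false]
            omega
        have hre : ready v p (j + 1) = ready w p (j + 1) := by
          ext s
          rw [mem_ready, mem_ready, hlt _ le_rfl, ← not_lt, hlt _ le_rfl, not_lt]
        rw [hpl, ← hCe p]
        refine Multiset.map_congr rfl fun s _ => ?_
        rw [gaps, hre, hpl, hkey _ le_rfl]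

end Columns

/-! ### From families of sequences to columns and collections -/

/-- The columns of a family of sequences, extended by zero. -/
def columns (w : Cell n m → Fin (2 * n)) (s : Slot n m) (p : ℕ) : ℕ :=
  if h : p < s.deg then (w ⟨s, ⟨p, h⟩⟩).val else 0

theorem columns_pos (w : Cell n m → Fin (2 * n)) (x : Cell n m) :
    columns w x.1 x.pos.val = (w x).val := dif_pos x.2.isLt

theorem columns_injective : Function.Injective (columns (n := n) (m := m)) := by
  intro w w' h
  funext x
  apply Fin.ext
  rw [← columns_pos w x, ← columns_pos w' x, h]

theorem columns_of_le (w : Cell n m → Fin (2 * n)) {s : Slot n m} {p : ℕ} (h : s.deg ≤ p) :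
    columns w s p = 0 := dif_neg (by omega)

theorem columns_lt (w : Cell n m → Fin (2 * n)) (s : Slot n m) (p : ℕ) :
    columns w s p < 2 * n := by
  have := s.deg_lt
  rw [columns]
  split_ifs
  · exact Fin.isLt _
  · omega

theorem isColumns_columns {w : Cell n m → Fin (2 * n)} (hw : IsAnti w)
    (hn : ∀ x, n ≤ (w x).val) : IsColumns Slot.deg (2 * n) (columns w) where
  zero _ _ := columns_of_le w
  pos s p h := by
    have h1 := hn ⟨s, ⟨p, h⟩⟩
    have h2 := s.deg_lt
    rw [columns, dif_pos h]
    omega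
  anti s p h _ := by
    rw [columns, columns, dif_pos h]
    split_ifs with h'
    · exact hw s (show (⟨p, h⟩ : Fin s.deg) < ⟨p + 1, h'⟩ from Nat.lt_succ_self p)
    · have h1 := hn ⟨s, ⟨p, h⟩⟩
      have h2 := s.deg_lt
      omega

theorem exists_eq_columns {v : Slot n m → ℕ → ℕ} (hv : IsColumns Slot.deg (2 * n) v)
    (hN : ∀ s p, v s p < 2 * n) : ∃ w : Cell n m → Fin (2 * n), IsAnti w ∧ columns w = v := by
  refine ⟨fun x => ⟨v x.1 x.2.val, hN _ _⟩, fun s i j hij => ?_, ?_⟩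
  · exact hv.anti_of_lt hij i.isLt (hN _ _)
  · funext s p
    rw [columns]
    split_ifs with h
    · rfl
    · exact (hv.zero s p (not_lt.1 h)).symm

theorem cellCount_eq_card_placed (w : Cell n m → Fin (2 * n)) (a : Fin (2 * n) × Fin (2 * n))
    (ha : 0 < a.2.val) : cellCount w a = (placed (columns w) a.1.val a.2.val).card := by
  rw [cellCount]
  refine Finset.card_bij (fun x _ => x.1) ?_ ?_ ?_
  · intro x hx
    obtain ⟨-, h1, h2⟩ := Finset.mem_filter.1 hx
    rw [mem_placed, ← h1, columns_pos, h2]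
  · intro x hx y hy h
    exact Cell.ext_pos h ((Finset.mem_filter.1 hx).2.1.trans (Finset.mem_filter.1 hy).2.1.symm)
  · intro s hs
    rw [mem_placed, columns] at hs
    split_ifs at hs with h
    · exact ⟨⟨s, ⟨a.1.val, h⟩⟩, by simp [Cell.pos, Fin.ext_iff, hs], rfl⟩
    · omega

/-- The collection of sets of pairs of a position and its entry. -/
def collOf (w : Cell n m → Fin (2 * n)) : Coll n m := fun s =>
  Finset.univ.image fun i : Fin s.deg => (Cell.pos ⟨s, i⟩, w ⟨s, i⟩)

theorem mem_collOf {w : Cell n m → Fin (2 * n)} {s : Slot n m} {a : Fin (2 * n) × Fin (2 * n)} :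
    a ∈ collOf w s ↔ a.1.val < s.deg ∧ columns w s a.1.val = a.2.val := by
  rw [collOf, Finset.mem_image]
  constructor
  · rintro ⟨i, -, rfl⟩
    exact ⟨i.isLt, columns_pos w ⟨s, i⟩⟩
  · rintro ⟨h, h'⟩
    refine ⟨⟨a.1.val, h⟩, Finset.mem_univ _, Prod.ext (Fin.ext rfl) (Fin.ext ?_)⟩
    rw [← h']
    exact (columns_pos w ⟨s, ⟨a.1.val, h⟩⟩).symm

theorem mem_restrict_collOf {w : Cell n m → Fin (2 * n)} {s : Slot n m}
    {a pq : Fin (2 * n) × Fin (2 * n)} :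
    a ∈ restrict (collOf w) pq s ↔ (a.1.val < s.deg ∧ columns w s a.1.val = a.2.val) ∧
      (a.2.val < pq.2.val ∨ a.2.val = pq.2.val ∧ a.1.val < pq.1.val) := by
  rw [restrict, Finset.mem_filter, mem_collOf, fLT, Fin.ext_iff]
  rfl

theorem card_restrict_collOf (w : Cell n m → Fin (2 * n)) (s : Slot n m)
    (pq : Fin (2 * n) × Fin (2 * n)) :
    (restrict (collOf w) pq s).card = ((Finset.range s.deg).filter fun i =>
      columns w s i < pq.2.val ∨ columns w s i = pq.2.val ∧ i < pq.1.val).card := by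
  refine Finset.card_bij (fun a _ => a.1.val) ?_ ?_ ?_
  · intro a ha
    rw [mem_restrict_collOf] at ha
    rw [Finset.mem_filter, Finset.mem_range, ha.1.2]
    exact ⟨ha.1.1, ha.2⟩
  · intro a ha b hb h
    rw [mem_restrict_collOf] at ha hb
    refine Prod.ext (Fin.ext h) (Fin.ext ?_)
    rw [← ha.1.2, ← hb.1.2, h]
  · intro i hi
    rw [Finset.mem_filter, Finset.mem_range] at hi
    have := s.deg_lt
    refine ⟨(⟨i, by omega⟩, ⟨columns w s i, columns_lt w s i⟩), ?_, rfl⟩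
    rw [mem_restrict_collOf]
    exact ⟨⟨hi.1, rfl⟩, hi.2⟩

/-- The decreasing list of the entries less than `q` of a column. -/
def entriesBelow (v : Slot n m → ℕ → ℕ) (q : ℕ) (s : Slot n m) : List (Fin (2 * n)) :=
  (Finset.univ.filter fun j : Fin (2 * n) => j.val < q ∧ ∃ i < s.deg, v s i = j.val).sort (· ≥ ·)

/-- The order of the pairs `(k, i)` with equal numbers of remaining entries. -/
def slotKey (v : Slot n m → ℕ → ℕ) (q : ℕ) (s : Slot n m) : List (Fin (2 * n)) ×ₗ ℕ :=
  toLex (entriesBelow v q s, s.2.val)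

theorem slotKey_congr (v v' : Slot n m → ℕ → ℕ) (q : ℕ)
    (h : ∀ s p, v s p < q ∨ v' s p < q → v s p = v' s p) : slotKey v q = slotKey v' q := by
  funext s
  rw [slotKey, slotKey, entriesBelow, entriesBelow]
  congr 3
  ext j
  simp only [Finset.mem_filter, Finset.mem_univ, true_and]
  refine and_congr_right fun hj => exists_congr fun i => and_congr_right fun _ => ?_
  constructor <;> intro h1
  · rw [← h s i (by omega), h1]
  · rw [h s i (by omega), h1]

/-- For a ready slot the entries below `q` are exactly those after position `p`, and they are
distinct. -/
theorem length_entriesBelow {v : Slot n m → ℕ → ℕ} (hv : IsColumns Slot.deg (2 * n) v) {p q : ℕ}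
    (hq : q ≤ 2 * n) {s : Slot n m} (hs : s ∈ ready v p q) :
    (entriesBelow v q s).length = s.deg - (p + 1) := by
  rw [mem_ready] at hs
  rw [entriesBelow, Finset.length_sort, ← Nat.card_Ico]
  symm
  refine Finset.card_bij (fun i hi => ⟨v s i, ?_⟩) ?_ ?_ ?_
  · have := hv.lt_of_le hq hs.1 (Finset.mem_Ico.1 hi).1
    omega
  · intro i hi
    rw [Finset.mem_Ico] at hi
    rw [Finset.mem_filter]
    exact ⟨Finset.mem_univ _, hv.lt_of_le hq hs.1 hi.1, i, hi.2, rfl⟩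
  · intro i hi j hj h
    rw [Finset.mem_Ico] at hi hj
    have h' : v s i = v s j := congrArg Fin.val h
    rcases lt_trichotomy i j with hij | hij | hij
    · have := hv.anti_of_lt hij hi.2 ((hv.lt_of_le hq hs.1 hi.1).trans_le hq)
      omega
    · exact hij
    · have := hv.anti_of_lt hij hj.2 ((hv.lt_of_le hq hs.1 hj.1).trans_le hq)
      omega
  · intro j hj
    obtain ⟨-, hj, i, hi, hij⟩ := Finset.mem_filter.1 hj
    refine ⟨i, Finset.mem_Ico.2 ⟨?_, hi⟩, Fin.ext hij⟩
    by_contra hip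
    have hip : i ≤ p := by omega
    have := hv.lt_of_le hq (by omega : v s i < q) hip
    omega

/-- On ready slots the length of the first component recovers `k`, and the second component is `i`.
-/
theorem slotKey_injOn {v : Slot n m → ℕ → ℕ} (hv : IsColumns Slot.deg (2 * n) v) (p q : ℕ)
    (hq : q ≤ 2 * n) : Set.InjOn (slotKey v q) (ready v p q) := by
  intro s hs t ht h
  have h' := (Prod.ext_iff.1 (toLex.injective h))
  have h1 := congrArg List.length h'.1
  simp only at h1
  rw [length_entriesBelow hv hq hs, length_entriesBelow hv hq ht] at h1
  have h2 := h'.2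
  have hsd : ∀ {s : Slot n m}, s ∈ ready v p q → p < s.deg := by
    intro s hs
    rw [mem_ready] at hs
    exact hv.lt_of_pos (by omega)
  have h3 := hsd hs
  have h4 := hsd ht
  have h5 : s.deg = t.deg := by omega
  obtain ⟨k, i⟩ := s
  obtain ⟨l, j⟩ := t
  have hkl : k = l := by
    simp only [Slot.deg] at h5
    exact Fin.ext (by omega)
  subst hkl
  have : i = j := Fin.ext h2
  rw [this]

theorem isFilling_collOf {w : Cell n m → Fin (2 * n)} (hw : IsAnti w)
    (hn : ∀ x, n ≤ (w x).val) (s : Slot n m) : IsFilling s.deg (collOf w s) := by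
  have hW := isColumns_columns hw hn
  have hdeg := s.deg_lt
  refine ⟨fun a ha => ?_, fun a ha b hb hab => ?_⟩
  · rw [collOf, Finset.mem_image] at ha
    obtain ⟨i, -, rfl⟩ := ha
    exact ⟨i.isLt, hdeg.le.trans (hn _)⟩
  · rw [mem_collOf] at ha hb
    rcases lt_trichotomy a.1.val b.1.val with h | h | h
    · have := hW.anti_of_lt h ha.1 (columns_lt _ _ _)
      rw [ha.2, hb.2] at this
      exact Or.inl ⟨h, this⟩
    · exact absurd (Prod.ext (Fin.ext h) (Fin.ext (by rw [← ha.2, ← hb.2, h]))) hab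
    · have := hW.anti_of_lt h hb.1 (columns_lt _ _ _)
      rw [ha.2, hb.2] at this
      exact Or.inr ⟨h, this⟩

/-! ### Admissible pairs and the degree as a gap number -/

theorem admissible_collOf_iff {w : Cell n m → Fin (2 * n)} (hw : IsAnti w)
    (hn : ∀ x, n ≤ (w x).val) (pq : Fin (2 * n) × Fin (2 * n)) (hq : n ≤ pq.2.val)
    (s : Slot n m) : Admissible (collOf w) pq s ↔
      pq.1.val < s.deg ∧ ∀ a ∈ restrict (collOf w) pq s, pq.1.val < a.1.val := by
  have hdeg := s.deg_lt
  constructor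
  · rintro ⟨h1, h2⟩
    refine ⟨(h1 pq (Finset.mem_insert_self _ _)).1, fun a ha => ?_⟩
    have hlt := (mem_restrict_collOf.1 ha).2
    have hne : pq ≠ a := by
      rintro rfl
      omega
    rcases h2 pq (Finset.mem_insert_self _ _) a (Finset.mem_insert_of_mem ha) hne with h | h
    · exact h.1
    · have := Fin.lt_def.1 h.2
      omega
  · rintro ⟨h1, h2⟩
    have hf := isFilling_collOf hw hn s
    have hmem : ∀ a ∈ restrict (collOf w) pq s, a ∈ collOf w s := fun a ha =>
      (Finset.mem_filter.1 ha).1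
    have hlt : ∀ a ∈ restrict (collOf w) pq s, pq.1 < a.1 ∧ a.2 < pq.2 := by
      intro a ha
      have h3 := h2 a ha
      have h4 := (mem_restrict_collOf.1 ha).2
      exact ⟨h3, Fin.lt_def.2 (by omega)⟩
    refine ⟨fun a ha => ?_, fun a ha b hb hab => ?_⟩
    · rcases Finset.mem_insert.1 ha with rfl | ha
      · exact ⟨h1, by omega⟩
      · exact hf.1 a (hmem a ha)
    · rcases Finset.mem_insert.1 ha with rfl | ha <;> rcases Finset.mem_insert.1 hb with rfl | hb
      · exact absurd rfl hab
      · exact Or.inl (hlt b hb)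
      · exact Or.inr (hlt a ha)
      · exact hf.2 a (hmem a ha) b (hmem b hb) hab

theorem restrict_collOf_of_ready {w : Cell n m → Fin (2 * n)} (hw : IsAnti w)
    (hn : ∀ x, n ≤ (w x).val) {pq : Fin (2 * n) × Fin (2 * n)} {s : Slot n m}
    (hs : s ∈ ready (columns w) pq.1.val pq.2.val) (a : Fin (2 * n) × Fin (2 * n)) :
    a ∈ restrict (collOf w) pq s ↔
      a ∈ collOf w s ∧ a.2.val < pq.2.val ∧ pq.1.val < a.1.val := by
  have hW := isColumns_columns hw hn
  rw [mem_ready] at hs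
  rw [mem_restrict_collOf, mem_collOf]
  refine and_congr_right fun ha => ?_
  rw [← ha.2]
  constructor
  · intro h
    have hlt : pq.1.val < a.1.val := by
      by_contra hle
      rcases (not_lt.1 hle).lt_or_eq with h1 | h1
      · have := hW.anti_of_lt h1 ha.1 (columns_lt _ _ _)
        omega
      · rw [h1] at h
        omega
    exact ⟨hW.lt_of_le pq.2.isLt.le hs.1 hlt, hlt⟩
  · exact fun h => Or.inl h.1

theorem admissible_of_ready {w : Cell n m → Fin (2 * n)} (hw : IsAnti w)
    (hn : ∀ x, n ≤ (w x).val) {pq : Fin (2 * n) × Fin (2 * n)} (hq : n ≤ pq.2.val)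
    {s : Slot n m} (hs : s ∈ ready (columns w) pq.1.val pq.2.val) :
    Admissible (collOf w) pq s := by
  have hW := isColumns_columns hw hn
  rw [admissible_collOf_iff hw hn pq hq]
  refine ⟨?_, fun a ha => ((restrict_collOf_of_ready hw hn hs a).1 ha).2.2⟩
  rw [mem_ready] at hs
  exact hW.lt_of_pos (by omega)

theorem qVec_of_ready {w : Cell n m → Fin (2 * n)} (hw : IsAnti w)
    (hn : ∀ x, n ≤ (w x).val) {pq : Fin (2 * n) × Fin (2 * n)}
    {s : Slot n m} (hs : s ∈ ready (columns w) pq.1.val pq.2.val) :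
    qVec (restrict (collOf w) pq s) = entriesBelow (columns w) pq.2.val s := by
  have hW := isColumns_columns hw hn
  rw [qVec, entriesBelow]
  congr 1
  ext j
  rw [Finset.mem_image, Finset.mem_filter]
  constructor
  · rintro ⟨a, ha, rfl⟩
    obtain ⟨h1, h2, -⟩ := (restrict_collOf_of_ready hw hn hs a).1 ha
    rw [mem_collOf] at h1
    exact ⟨Finset.mem_univ _, h2, a.1.val, h1⟩
  · rintro ⟨-, hj, i, hi, hij⟩
    have := s.deg_lt
    refine ⟨(⟨i, by omega⟩, j), ?_, rfl⟩
    rw [mem_restrict_collOf]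
    exact ⟨⟨hi, hij⟩, Or.inl hj⟩

theorem card_restrict_of_ready {w : Cell n m → Fin (2 * n)} (hw : IsAnti w)
    (hn : ∀ x, n ≤ (w x).val) {pq : Fin (2 * n) × Fin (2 * n)}
    {s : Slot n m} (hs : s ∈ ready (columns w) pq.1.val pq.2.val) :
    (restrict (collOf w) pq s).card = s.deg - (pq.1.val + 1) := by
  rw [card_restrict_collOf, ← Nat.card_Ico]
  congr 1
  have hW := isColumns_columns hw hn
  have hs' := mem_ready.1 hs
  ext i
  rw [Finset.mem_filter, Finset.mem_range, Finset.mem_Ico]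
  constructor
  · rintro ⟨hi, h⟩
    refine ⟨?_, hi⟩
    by_contra hle
    rcases (Nat.le_of_lt_succ (not_le.1 hle)).lt_or_eq with h1 | h1
    · have := hW.anti_of_lt h1 hi (columns_lt _ _ _)
      omega
    · rw [h1] at h
      omega
  · rintro ⟨h, hi⟩
    exact ⟨hi, Or.inl (hW.lt_of_le pq.2.isLt.le hs'.1 h)⟩

/-- Admissibility keeps the restricted set at positions after `p`. If the slot is not ready,
position `p + 1` exists and its entry is at least `q`, so the set misses it. -/
theorem card_restrict_of_admissible {w : Cell n m → Fin (2 * n)} (hw : IsAnti w)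
    (hn : ∀ x, n ≤ (w x).val) {pq : Fin (2 * n) × Fin (2 * n)} (hq : n ≤ pq.2.val)
    {s : Slot n m} (hs : Admissible (collOf w) pq s)
    (hs' : s ∉ ready (columns w) pq.1.val pq.2.val) :
    (restrict (collOf w) pq s).card < s.deg - (pq.1.val + 1) := by
  have hdeg := s.deg_lt
  rw [card_restrict_collOf, ← Nat.card_Ico]
  rw [admissible_collOf_iff hw hn pq hq] at hs
  have hsub : ∀ i < s.deg, (columns w s i < pq.2.val ∨ columns w s i = pq.2.val ∧ i < pq.1.val) →
      pq.1.val < i := by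
    intro i hi h
    exact hs.2 (⟨i, by omega⟩, ⟨columns w s i, columns_lt w s i⟩)
      (mem_restrict_collOf.2 ⟨⟨hi, rfl⟩, h⟩)
  rw [mem_ready, not_and_or, not_lt, not_le] at hs'
  rcases hs' with h | h
  · refine Finset.card_lt_card ⟨fun i hi => ?_, fun hsub' => ?_⟩
    · rw [Finset.mem_filter, Finset.mem_range] at hi
      exact Finset.mem_Ico.2 ⟨hsub i hi.1 hi.2, hi.1⟩
    · have hp : pq.1.val + 1 < s.deg := by
        by_contra h'
        rw [columns_of_le w (not_lt.1 h')] at h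
        omega
      have := hsub' (Finset.mem_Ico.2 ⟨le_rfl, hp⟩)
      rw [Finset.mem_filter] at this
      omega
  · exact absurd (hsub _ hs.1 (Or.inl h)) (lt_irrefl _)

/-- With positions starting at `0`, ready slots all have `k - l = p + 1`, while admissible slots
that are not ready have a larger value and cannot precede a placed slot. Among ready slots the order
is that of `slotKey`. -/
theorem tDeg_collOf {w : Cell n m → Fin (2 * n)} (hw : IsAnti w)
    (hn : ∀ x, n ≤ (w x).val) (pq : Fin (2 * n) × Fin (2 * n)) (hq : n ≤ pq.2.val)
    {s : Slot n m} (hs : s ∈ placed (columns w) pq.1.val pq.2.val) :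
    tDeg (collOf w) pq s = gaps slotKey (columns w) pq.1.val pq.2.val s := by
  have hW := isColumns_columns hw hn
  have hdeg := s.deg_lt
  have hsr := hW.placed_subset_ready (by omega) pq.2.isLt hs
  have hp : pq.1.val < s.deg := by
    rw [mem_placed] at hs
    exact hW.lt_of_pos (by omega)
  rw [tDeg, gaps]
  congr 1
  ext t
  rw [Finset.mem_filter, Finset.mem_filter, Finset.mem_sdiff, mem_placed, SlotLT,
    card_restrict_of_ready hw hn hsr, qVec_of_ready hw hn hsr, mem_collOf, slotKey, slotKey,
    Prod.Lex.toLex_lt_toLex]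
  simp only [Finset.mem_univ, true_and]
  by_cases ht : t ∈ ready (columns w) pq.1.val pq.2.val
  · have hpt : pq.1.val < t.deg := by
      rw [mem_ready] at ht
      exact hW.lt_of_pos (by omega)
    rw [card_restrict_of_ready hw hn ht, qVec_of_ready hw hn ht]
    have h1 : ((t.deg : ℤ) - ((t.deg - (pq.1.val + 1) : ℕ) : ℤ)) = pq.1.val + 1 := by omega
    have h2 : ((s.deg : ℤ) - ((s.deg - (pq.1.val + 1) : ℕ) : ℤ)) = pq.1.val + 1 := by omega
    simp only [h1, h2, lt_irrefl, false_or, true_and, ht, hpt, admissible_of_ready hw hn hq ht]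
    exact and_comm
  · simp only [ht, false_and, iff_false, not_and]
    intro had hlt
    have h1 := card_restrict_of_admissible hw hn hq had ht
    omega

/-! ### Reading exponents off `Π(B)` -/

theorem filter_flatMap_eq {α β : Type*} [DecidableEq α] (P : List α) (hP : P.Nodup)
    (F : α → List (α × β)) (hF : ∀ b, ∀ y ∈ F b, y.1 = b) (a : α) (ha : a ∈ P) :
    (P.flatMap F).filter (fun y => y.1 = a) = F a := by
  induction P with
  | nil => simp at ha
  | cons b P ih =>
    rw [List.flatMap_cons, List.filter_append]
    rw [List.nodup_cons] at hP
    by_cases hb : b = a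
    · subst hb
      rw [List.filter_eq_self.2, List.filter_eq_nil_iff.2, List.append_nil]
      · intro y hy
        obtain ⟨c, hc, hy⟩ := List.mem_flatMap.1 hy
        rw [hF c y hy]
        simp only [decide_eq_true_eq]
        rintro rfl
        exact hP.1 hc
      · intro y hy
        simpa using hF b y hy
    · rw [List.filter_eq_nil_iff.2, List.nil_append,
        ih hP.2 ((List.mem_cons.1 ha).resolve_left (Ne.symm hb))]
      intro y hy
      rw [hF b y hy]
      simpa using hb

theorem mem_pairsDesc {N : ℕ} (a : Fin N × Fin N) : a ∈ pairsDesc N := by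
  rw [pairsDesc, List.mem_flatMap]
  exact ⟨a.2, by simp, by simp⟩

theorem nodup_pairsDesc (N : ℕ) : (pairsDesc N).Nodup := by
  rw [pairsDesc, List.nodup_flatMap]
  refine ⟨fun q _ => ?_, ?_⟩
  · refine List.Nodup.map (fun a b h => (Prod.mk.inj h).1) ?_
    simp [List.nodup_finRange]
  · have h : (List.finRange N).reverse.Nodup := by simp [List.nodup_finRange]
    refine h.imp fun {a b} hab => ?_
    rw [Function.onFun, List.disjoint_left]
    intro y hy hy'
    obtain ⟨_, -, rfl⟩ := List.mem_map.1 hy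
    obtain ⟨_, -, h'⟩ := List.mem_map.1 hy'
    exact hab (Prod.mk.inj h').2.symm

theorem coe_slotList : (slotList n m : Multiset (Slot n m)) = Finset.univ.val := by
  refine (Multiset.Nodup.ext ?_ Finset.univ.nodup).2 fun s => ?_
  · rw [Multiset.coe_nodup, slotList, List.nodup_flatMap]
    refine ⟨fun k _ => ?_, ?_⟩
    · refine List.Nodup.map (fun a b h => ?_) (List.nodup_finRange _)
      exact eq_of_heq (Sigma.mk.inj h).2
    · refine (List.nodup_finRange _).imp fun {a b} hab => ?_
      rw [Function.onFun, List.disjoint_left]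
      intro y hy hy'
      obtain ⟨_, -, rfl⟩ := List.mem_map.1 hy
      obtain ⟨_, -, h'⟩ := List.mem_map.1 hy'
      exact hab (Sigma.mk.inj h').1.symm
  · simp only [Multiset.mem_coe, Finset.mem_val, Finset.mem_univ, iff_true]
    rw [slotList, List.mem_flatMap]
    exact ⟨s.1, List.mem_finRange _, List.mem_map.2 ⟨s.2, List.mem_finRange _, rfl⟩⟩

theorem exponents_factors (B : Coll n m) (a : Fin (2 * n) × Fin (2 * n)) :
    ((((factors B).filter fun y => y.1 = a).map Prod.snd : List ℕ) : Multiset ℕ) =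
      (Finset.univ.filter fun s => a ∈ B s).val.map (tDeg B a) := by
  rw [factors, filter_flatMap_eq _ (nodup_pairsDesc _) _ ?_ a (mem_pairsDesc a), List.map_map,
    ← Multiset.map_coe, ← Multiset.filter_coe, coe_slotList]
  · rfl
  · intro b y hy
    obtain ⟨_, -, rfl⟩ := List.mem_map.1 hy
    rfl

theorem placed_columns_eq {w : Cell n m → Fin (2 * n)} (a : Fin (2 * n) × Fin (2 * n))
    (ha : 0 < a.2.val) :
    (Finset.univ.filter fun s => a ∈ collOf w s) = placed (columns w) a.1.val a.2.val := by
  ext s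
  rw [mem_placed, Finset.mem_filter, mem_collOf]
  refine ⟨fun h => h.2.2, fun h => ⟨Finset.mem_univ _, ?_, h⟩⟩
  by_contra h'
  rw [columns_of_le w (not_lt.1 h')] at h
  omega

theorem mem_factors {B : Coll n m} {y : (Fin (2 * n) × Fin (2 * n)) × ℕ} (hy : y ∈ factors B) :
    ∃ s, y.1 ∈ B s := by
  obtain ⟨a, -, hy⟩ := List.mem_flatMap.1 hy
  obtain ⟨s, hs, rfl⟩ := List.mem_map.1 hy
  exact ⟨s, by simpa using (List.mem_filter.1 hs).2⟩

theorem le_of_mem_collOf {w : Cell n m → Fin (2 * n)} (hn : ∀ x, n ≤ (w x).val) {s : Slot n m}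
    {a : Fin (2 * n) × Fin (2 * n)} (ha : a ∈ collOf w s) : a.1.val < n ∧ n ≤ a.2.val := by
  rw [collOf, Finset.mem_image] at ha
  obtain ⟨i, -, rfl⟩ := ha
  exact ⟨Cell.pos_lt _, hn _⟩

theorem count_eq_count_exponents {α β : Type*} [DecidableEq α] [BEq β] [LawfulBEq β]
    [BEq (α × β)] [LawfulBEq (α × β)] (l : List (α × β)) (y : α × β) :
    l.count y = ((l.filter fun z => z.1 = y.1).map Prod.snd).count y.2 := by
  rw [List.count, List.count, List.countP_map, List.countP_filter]
  refine List.countP_congr fun z _ => ?_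
  simp [Prod.ext_iff, and_comm]

theorem count_map_fst_eq {α β : Type*} [DecidableEq α] [BEq α] [LawfulBEq α] (l : List (α × β)) (a : α) :
    (l.map Prod.fst).count a = ((l.filter fun z => z.1 = a).map Prod.snd).length := by
  rw [List.length_map, List.count, List.countP_map, List.countP_eq_length_filter]
  congr 1
  refine List.filter_congr fun z _ => ?_
  exact beq_eq_decide z.1 a

/-- A list of factors is determined up to order by the multiset of exponents of each pair, and for
`collOf w` these are the gap numbers. -/
theorem factors_perm {w : Cell n m → Fin (2 * n)} (hw : IsAnti w) (hn : ∀ x, n ≤ (w x).val)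
    (l : List ((Fin (2 * n) × Fin (2 * n)) × ℕ))
    (hl : ∀ y ∈ l, n ≤ y.1.2.val)
    (h : ∀ a : Fin (2 * n) × Fin (2 * n), n ≤ a.2.val →
      (placed (columns w) a.1.val a.2.val).val.map
          (gaps slotKey (columns w) a.1.val a.2.val) =
        (((l.filter fun y => y.1 = a).map Prod.snd : List ℕ) : Multiset ℕ)) :
    l.Perm (factors (collOf w)) := by
  rw [List.perm_iff_count]
  intro y
  by_cases hy : n ≤ y.1.2.val
  · have h1 := h y.1 hy
    have hpos : 0 < y.1.2.val := by have := y.1.2.isLt; omega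
    rw [count_eq_count_exponents, count_eq_count_exponents (factors _), ← Multiset.coe_count,
      ← Multiset.coe_count, ← h1, exponents_factors, placed_columns_eq _ hpos]
    congr 1
    exact Multiset.map_congr rfl fun s hs => (tDeg_collOf hw hn y.1 hy hs).symm
  · rw [List.count_eq_zero.2 fun h' => hy (hl y h'), List.count_eq_zero.2]
    intro h'
    obtain ⟨s, hs⟩ := mem_factors h'
    exact hy (le_of_mem_collOf hn hs).2

theorem count_factors_collOf (w : Cell n m → Fin (2 * n)) (a : Fin (2 * n) × Fin (2 * n))
    (ha : n ≤ a.2.val) : ((factors (collOf w)).map Prod.fst).count a = cellCount w a := by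
  have hpos : 0 < a.2.val := by have := a.2.isLt; omega
  rw [count_map_fst_eq, ← Multiset.coe_card, exponents_factors, Multiset.card_map,
    cellCount_eq_card_placed w a hpos, placed_columns_eq a hpos]
  rfl

/-! ### Entry counts, weights and the set `𝔹_μ` -/

theorem sum_eq_sum_cellCount (w : Cell n m → Fin (2 * n))
    (f : Fin (2 * n) → Fin (2 * n) → ℕ) :
    ∑ x, f x.pos (w x) = ∑ a : Fin (2 * n) × Fin (2 * n), cellCount w a * f a.1 a.2 := by
  rw [← Finset.sum_fiberwise_of_maps_to (s := Finset.univ) (t := Finset.univ)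
    (g := fun x => (x.pos, w x)) (by simp)]
  refine Finset.sum_congr rfl fun a _ => ?_
  rw [Finset.sum_congr rfl (g := fun _ => f a.1 a.2), Finset.sum_const, smul_eq_mul, cellCount]
  · congr 2
    ext x
    simp [Prod.ext_iff]
  · intro x hx
    rw [← (Finset.mem_filter.1 hx).2]

theorem content_eq_sum_cellCount (w : Cell n m → Fin (2 * n)) (j : Fin (2 * n)) :
    content w j = ∑ a : Fin (2 * n) × Fin (2 * n), cellCount w a * if a.2 = j then 1 else 0 := by
  rw [← sum_eq_sum_cellCount w fun _ b => if b = j then 1 else 0, content, Finset.card_filter]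

/-- A family with the same numbers of large entries at all positions as one with only large entries
has only large entries. -/
theorem le_of_cellCount_eq {w w' : Cell n m → Fin (2 * n)} (hn : ∀ x, n ≤ (w x).val)
    (h : ∀ a : Fin (2 * n) × Fin (2 * n), n ≤ a.2.val → cellCount w' a = cellCount w a)
    (x : Cell n m) : n ≤ (w' x).val := by
  have h1 := sum_eq_sum_cellCount w fun _ b => if n ≤ b.val then 1 else 0
  have h2 := sum_eq_sum_cellCount w' fun _ b => if n ≤ b.val then 1 else 0
  have h3 : ∑ a : Fin (2 * n) × Fin (2 * n), cellCount w' a * (if n ≤ a.2.val then 1 else 0) =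
      ∑ a : Fin (2 * n) × Fin (2 * n), cellCount w a * (if n ≤ a.2.val then 1 else 0) := by
    refine Finset.sum_congr rfl fun a _ => ?_
    split_ifs with ha
    · rw [h a ha]
    · rfl
  rw [h3, ← h1, ← Finset.card_filter, ← Finset.card_filter,
    Finset.filter_true_of_mem (p := fun x => n ≤ (w x).val) (fun x _ => hn x)] at h2
  exact (Finset.card_filter_eq_iff.1 h2) x (Finset.mem_univ x)

theorem cellCount_eq_of_le {w w' : Cell n m → Fin (2 * n)} (hn : ∀ x, n ≤ (w x).val)
    (hn' : ∀ x, n ≤ (w' x).val)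
    (h : ∀ a : Fin (2 * n) × Fin (2 * n), n ≤ a.2.val → cellCount w' a = cellCount w a) :
    cellCount w' = cellCount w := by
  have h0 : ∀ {w : Cell n m → Fin (2 * n)}, (∀ x, n ≤ (w x).val) →
      ∀ a : Fin (2 * n) × Fin (2 * n), ¬ n ≤ a.2.val → cellCount w a = 0 := by
    intro w hw a ha
    rw [cellCount, Finset.card_eq_zero, Finset.filter_eq_empty_iff]
    rintro x - ⟨-, h⟩
    exact ha (h ▸ hw x)
  funext a
  by_cases ha : n ≤ a.2.val
  · exact h a ha
  · rw [h0 hn a ha, h0 hn' a ha]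

theorem content_eq_of_cellCount {w w' : Cell n m → Fin (2 * n)} (h : cellCount w' = cellCount w)
    (j : Fin (2 * n)) : content w' j = content w j := by
  rw [content_eq_sum_cellCount, content_eq_sum_cellCount, h]

/-- Each of the first `k` indices is replaced exactly once, so the highest weight cancels and only
the entries remain. -/
theorem collWeight_collOf (w : Cell n m → Fin (2 * n)) (j : Fin (2 * n)) :
    collWeight (collOf w) j = content w j := by
  rw [collWeight, content, Finset.card_filter, Nat.cast_sum]
  refine Eq.trans ?_ (Fintype.sum_sigma _).symm
  refine Finset.sum_congr rfl fun s _ => ?_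
  rw [collOf, Finset.sum_image, Finset.sum_sub_distrib, add_sub_left_comm, add_eq_left.2]
  · simp
  · rw [sub_eq_zero]
    by_cases hj : j.val < s.deg
    · rw [if_pos hj, Finset.sum_eq_single ⟨j.val, hj⟩]
      · rw [if_pos]
        exact Fin.ext rfl
      · intro i _ hi
        rw [if_neg]
        rintro rfl
        exact hi rfl
      · simp
    · rw [if_neg hj, Finset.sum_eq_zero]
      intro i _
      rw [if_neg]
      rintro rfl
      exact hj i.isLt
  · intro i _ i' _ h
    exact Fin.ext (congrArg (fun a => a.1.val) h)

theorem le_of_content_eq {μ : Fin (2 * n) → ℕ} (hμ : ∀ j : Fin (2 * n), j.val < n → μ j = 0)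
    {w : Cell n m → Fin (2 * n)} (hw : ∀ j, content w j = μ j) (x : Cell n m) :
    n ≤ (w x).val := by
  by_contra h
  have h1 := hw (w x)
  rw [hμ _ (not_le.1 h), content, Finset.card_eq_zero, Finset.filter_eq_empty_iff] at h1
  exact h1 (Finset.mem_univ x) rfl

/-- F2 makes the first indices in a set distinct, so every factor contributes a nonnegative
coefficient of `ε_j`. If the total vanishes for all `j < n`, each factor must replace each of its
first `k` indices. -/
theorem exists_eq_collOf {μ : Fin (2 * n) → ℕ} (hμ : ∀ j : Fin (2 * n), j.val < n → μ j = 0)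
    {B : Coll n m} (hB : B ∈ fillingsOfWeight n m μ) :
    ∃ w : Cell n m → Fin (2 * n), (IsAnti w ∧ ∀ j, content w j = μ j) ∧ collOf w = B := by
  obtain ⟨hF, hW⟩ := hB
  have hinj : ∀ s, ∀ a ∈ B s, ∀ b ∈ B s, a.1 = b.1 → a = b := by
    intro s a ha b hb hab
    by_contra hne
    rcases (hF s).2 a ha b hb hne with h | h
    · exact absurd h.1 (hab ▸ lt_irrefl _)
    · exact absurd h.1 (hab ▸ lt_irrefl _)
  have hone : ∀ s j, ∑ a ∈ B s, (if a.1 = j then (1 : ℤ) else 0) ≤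
      if j.val < s.deg then 1 else 0 := by
    intro s j
    rw [Finset.sum_boole]
    split_ifs with hj
    · exact_mod_cast Finset.card_le_one.2 fun a ha b hb =>
        hinj s a (Finset.mem_filter.1 ha).1 b (Finset.mem_filter.1 hb).1
          (Eq.trans (Finset.mem_filter.1 ha).2 (Eq.symm (Finset.mem_filter.1 hb).2))
    · rw [Finset.filter_eq_empty_iff.2, Finset.card_empty, Nat.cast_zero]
      rintro a ha rfl
      exact hj ((hF s).1 a ha).1
  have hnn : ∀ s (j : Fin (2 * n)), 0 ≤ ∑ a ∈ B s, (if a.2 = j then (1 : ℤ) else 0) := by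
    intro s j
    rw [Finset.sum_boole]
    exact Nat.cast_nonneg _
  have hzero : ∀ j : Fin (2 * n), j.val < n → ∀ s,
      (if j.val < s.deg then (1 : ℤ) else 0) + ∑ a ∈ B s,
        ((if a.2 = j then 1 else 0) - (if a.1 = j then 1 else 0)) = 0 := by
    intro j hj s
    have h1 := hW j
    rw [hμ j hj, collWeight, Nat.cast_zero] at h1
    refine (Finset.sum_eq_zero_iff_of_nonneg fun s _ => ?_).1 h1 s (Finset.mem_univ s)
    rw [Finset.sum_sub_distrib]
    have := hone s j
    have := hnn s j
    omega
  have hex : ∀ x : Cell n m, ∃ q, (x.pos, q) ∈ B x.1 := by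
    intro x
    by_contra h
    have h1 := hzero x.pos x.pos_lt x.1
    rw [if_pos (show x.pos.val < x.1.deg from x.2.isLt), Finset.sum_sub_distrib] at h1
    have h2 : ∑ a ∈ B x.1, (if a.1 = x.pos then (1 : ℤ) else 0) = 0 := by
      refine Finset.sum_eq_zero fun a ha => if_neg fun h2 => ?_
      exact h ⟨a.2, by rw [← h2]; exact ha⟩
    have := hnn x.1 x.pos
    omega
  choose w hwB using hex
  have hcoll : collOf w = B := by
    funext s
    ext a
    rw [collOf, Finset.mem_image]
    constructor
    · rintro ⟨i, -, rfl⟩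
      exact hwB ⟨s, i⟩
    · intro ha
      exact ⟨⟨a.1.val, ((hF s).1 a ha).1⟩, Finset.mem_univ _, hinj s _ (hwB ⟨s, _⟩) a ha rfl⟩
  refine ⟨w, ⟨fun s i j hij => ?_, fun j => ?_⟩, hcoll⟩
  · have hlt : Cell.pos (⟨s, i⟩ : Cell n m) < Cell.pos ⟨s, j⟩ := hij
    rcases (hF s).2 _ (hwB ⟨s, i⟩) _ (hwB ⟨s, j⟩) (fun h => hlt.ne (congrArg Prod.fst h)) with h | h
    · exact h.2
    · exact absurd h.1 hlt.asymm
  · have := hW j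
    rw [← hcoll, collWeight_collOf] at this
    exact_mod_cast this

theorem collOf_mem_fillingsOfWeight {μ : Fin (2 * n) → ℕ} {w : Cell n m → Fin (2 * n)}
    (hw : IsAnti w) (hn : ∀ x, n ≤ (w x).val) (hc : ∀ j, content w j = μ j) :
    collOf w ∈ fillingsOfWeight n m μ :=
  ⟨isFilling_collOf hw hn, fun j => by rw [collWeight_collOf, hc]⟩

/-- The wedges occurring in `𝓕(B)` have the same numbers of entries at all positions as the family
defining `B`, hence the same weight. -/
theorem fVec_mem_weightSpace (ζ : Slot n m → K) {μ : Fin (2 * n) → ℕ}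
    (hμ : ∀ j : Fin (2 * n), j.val < n → μ j = 0) {B : Coll n m}
    (hB : B ∈ fillingsOfWeight n m μ) : fVec K ζ B ∈ weightSpace K n m μ := by
  obtain ⟨w, ⟨hw, hc⟩, rfl⟩ := exists_eq_collOf hμ hB
  have hn := le_of_content_eq hμ hc
  rw [fVec_eq]
  refine Submodule.span_le.2 ?_ (monomial_cyclicVec_mem ζ _ fun y hy => ?_)
  · rintro _ ⟨w', hw', rfl⟩
    have h1 : ∀ a : Fin (2 * n) × Fin (2 * n), n ≤ a.2.val → cellCount w' a = cellCount w a :=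
      fun a ha => (hw'.2 a ha).trans (count_factors_collOf w a ha)
    refine wedge_mem_weightSpace w' μ fun j => ?_
    rw [content_eq_of_cellCount (cellCount_eq_of_le hn (le_of_cellCount_eq hn h1) h1), hc]
  · obtain ⟨s, hs⟩ := mem_factors hy
    exact le_of_mem_collOf hn hs

/-- The pairs of a position and its entry, over all cells. -/
def cellPairs (w : Cell n m → Fin (2 * n)) : List (Fin (2 * n) × Fin (2 * n)) :=
  (Finset.univ : Finset (Cell n m)).toList.map fun x => (x.pos, w x)

theorem count_cellPairs (w : Cell n m → Fin (2 * n)) (a : Fin (2 * n) × Fin (2 * n)) :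
    (cellPairs w).count a = cellCount w a := by
  have h : ∀ x : Cell n m, ((fun b => b == a) ∘ fun x => (x.pos, w x)) x =
      decide (x.pos = a.1 ∧ w x = a.2) := fun x => by
    rw [Function.comp_apply, beq_eq_decide]
    simp only [Prod.ext_iff]
  rw [cellPairs, List.count, List.countP_map, List.countP_eq_length_filter,
    List.filter_congr fun x _ => h x, ← Multiset.coe_card, ← Multiset.filter_coe,
    Finset.coe_toList, cellCount]
  rfl

theorem mem_cellPairs {w : Cell n m → Fin (2 * n)} (hn : ∀ x, n ≤ (w x).val)
    {a : Fin (2 * n) × Fin (2 * n)} (ha : a ∈ cellPairs w) : a.1.val < n ∧ n ≤ a.2.val := by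
  obtain ⟨x, -, rfl⟩ := List.mem_map.1 ha
  exact ⟨x.pos_lt, hn x⟩

theorem placed_columns_eq_empty {w : Cell n m → Fin (2 * n)} {p q : ℕ} (hp : 2 * n ≤ p)
    (hq : 0 < q) : placed (columns w) p q = ∅ := by
  refine Finset.eq_empty_of_forall_notMem fun s hs => ?_
  have := s.deg_lt
  rw [mem_placed, columns_of_le w (by omega)] at hs
  omega

/-- A product of elements `f_{pq} ⊗ t^d` with small exponents is `Π(B)` for some `B`. -/
theorem exists_monomial_eq_fVec (ζ : Slot n m → K) {w₀ : Cell n m → Fin (2 * n)}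
    (hw₀ : IsAnti w₀) (hn₀ : ∀ x, n ≤ (w₀ x).val)
    (l : List ((Fin (2 * n) × Fin (2 * n)) × ℕ)) (hl : l.map Prod.fst = cellPairs w₀)
    (hd : ∀ y ∈ l, y.2 + (placed (columns w₀) y.1.1.val y.1.2.val).card ≤
      (ready (columns w₀) y.1.1.val y.1.2.val).card) :
    ∃ B ∈ fillingsOfWeight n m (content w₀), fVec K ζ B = monomial ζ l (cyclicVec K n m) := by
  classical
  have hW₀ := isColumns_columns hw₀ hn₀
  have hln : ∀ y ∈ l, y.1.1.val < n ∧ n ≤ y.1.2.val := fun y hy =>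
    mem_cellPairs hn₀ (hl ▸ List.mem_map_of_mem (f := Prod.fst) hy)
  -- The exponents attached to each pair, indexed by all natural numbers as the abstract lemma on
  -- columns requires.
  let e : ℕ → ℕ → Multiset ℕ := fun p q =>
    ((l.filter fun y => y.1.1.val = p ∧ y.1.2.val = q).map Prod.snd : List ℕ)
  have he : ∀ a : Fin (2 * n) × Fin (2 * n), e a.1.val a.2.val =
      (((l.filter fun y => y.1 = a).map Prod.snd : List ℕ) : Multiset ℕ) := by
    intro a
    simp only [e, Prod.ext_iff, Fin.ext_iff]
  have hcard : ∀ p q, 0 < q → q < 2 * n → (e p q).card = (placed (columns w₀) p q).card := by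
    intro p q h0 hq
    by_cases hp : p < 2 * n
    · have h1 := he (⟨p, hp⟩, ⟨q, hq⟩)
      simp only at h1
      rw [h1, Multiset.coe_card, ← count_map_fst_eq, hl, count_cellPairs,
        cellCount_eq_card_placed _ _ h0]
    · rw [placed_columns_eq_empty (not_lt.1 hp) h0, Finset.card_empty, Multiset.card_eq_zero]
      simp only [e]
      rw [List.filter_eq_nil_iff.2, List.map_nil, Multiset.coe_nil]
      intro y _
      have := y.1.1.isLt
      simp only [decide_eq_true_eq, not_and]
      omega
  obtain ⟨v, hv, hvN, hve⟩ := exists_columns_of_gaps slotKey slotKey_congr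
    (fun v hv p q hq => slotKey_injOn hv p q hq) hW₀ (columns_lt w₀) e hcard (by
      intro p q h0 hq x hx
      rw [Multiset.mem_coe, List.mem_map] at hx
      obtain ⟨y, hy, rfl⟩ := hx
      rw [List.mem_filter, decide_eq_true_eq] at hy
      obtain ⟨hy, rfl, rfl⟩ := hy
      exact hd y hy)
  obtain ⟨w, hw, rfl⟩ := exists_eq_columns hv hvN
  have hcc : ∀ a : Fin (2 * n) × Fin (2 * n), n ≤ a.2.val → cellCount w a = cellCount w₀ a := by
    intro a ha
    have h0 : 0 < a.2.val := by have := a.2.isLt; omega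
    rw [cellCount_eq_card_placed w a h0, cellCount_eq_card_placed w₀ a h0,
      ← hcard _ _ h0 a.2.isLt, ← hve _ _ h0 a.2.isLt, Multiset.card_map]
    rfl
  have hn := le_of_cellCount_eq hn₀ hcc
  refine ⟨collOf w, collOf_mem_fillingsOfWeight hw hn
    (content_eq_of_cellCount (cellCount_eq_of_le hn₀ hn hcc)), ?_⟩
  rw [fVec_eq, monomial_perm ζ (factors_perm hw hn l (fun y hy => (hln y hy).2) fun a ha => ?_) hln]
  rw [hve _ _ (by have := a.2.isLt; omega) a.2.isLt, he]

/-! ### Gap polynomials isolate one decreasing wedge -/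

/-- The polynomial with roots `ζ_s` for the columns that are ready for an entry but do not have
it. -/
def gapPoly (ζ : Slot n m → K) (w : Cell n m → Fin (2 * n)) (a : Fin (2 * n) × Fin (2 * n)) :
    K[X] :=
  open Classical in
  ∏ s ∈ ready (columns w) a.1.val a.2.val \ placed (columns w) a.1.val a.2.val,
    (Polynomial.X - Polynomial.C (ζ s))

theorem eval_gapPoly_eq_zero_iff {ζ : Slot n m → K} (hζ : Function.Injective ζ)
    (w : Cell n m → Fin (2 * n)) (a : Fin (2 * n) × Fin (2 * n)) (s : Slot n m) :
    (gapPoly ζ w a).eval (ζ s) = 0 ↔ s ∈ ready (columns w) a.1.val a.2.val ∧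
      s ∉ placed (columns w) a.1.val a.2.val := by
  classical
  rw [gapPoly, Polynomial.eval_prod, Finset.prod_eq_zero_iff]
  simp only [Polynomial.eval_sub, Polynomial.eval_X, Polynomial.eval_C, sub_eq_zero, hζ.eq_iff,
    Finset.mem_sdiff]
  exact ⟨fun ⟨t, ht, h⟩ => h ▸ ht, fun h => ⟨s, h, rfl⟩⟩

theorem natDegree_gapPoly (ζ : Slot n m → K) (w : Cell n m → Fin (2 * n))
    (hw : IsColumns Slot.deg (2 * n) (columns w))
    (a : Fin (2 * n) × Fin (2 * n)) (ha : 0 < a.2.val) :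
    (gapPoly ζ w a).natDegree + (placed (columns w) a.1.val a.2.val).card =
      (ready (columns w) a.1.val a.2.val).card := by
  classical
  rw [gapPoly, Polynomial.natDegree_finsetProd_X_sub_C_eq_card]
  exact Finset.card_sdiff_add_card_eq_card (hw.placed_subset_ready ha a.2.isLt)

/-- The degree of the gap polynomial is exactly `#ready - #placed`, the largest exponent allowed in
`exists_monomial_eq_fVec`. So every monomial of the expansion gives some `𝓕(B)`. -/
theorem prod_gapPoly_mem (ζ : Slot n m → K) {w : Cell n m → Fin (2 * n)} (hw : IsAnti w)
    (hn : ∀ x, n ≤ (w x).val) :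
    ((cellPairs w).map fun a => lowering ζ a (gapPoly ζ w a)).prod (cyclicVec K n m) ∈
      Submodule.span K (Set.range fun B : fillingsOfWeight n m (content w) =>
        fVec K ζ B.val) := by
  have hW := isColumns_columns hw hn
  refine Submodule.span_induction (p := fun T _ => T (cyclicVec K n m) ∈ Submodule.span K
      (Set.range fun B : fillingsOfWeight n m (content w) => fVec K ζ B.val)) ?_ ?_ ?_ ?_
    (prod_lowering_mem_span ζ (gapPoly ζ w) (cellPairs w))
  · rintro _ ⟨l, ⟨hl, hd⟩, rfl⟩
    obtain ⟨B, hB, h⟩ := exists_monomial_eq_fVec ζ hw hn l hl fun y hy => by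
      have h1 := (mem_cellPairs hn (hl ▸ List.mem_map_of_mem (f := Prod.fst) hy)).2
      have h2 := y.1.2.isLt
      rw [← natDegree_gapPoly ζ w hW y.1 (by omega)]
      exact Nat.add_le_add_right (hd y hy) _
    exact Submodule.subset_span ⟨⟨B, hB⟩, h⟩
  · exact Submodule.zero_mem _
  · intro S T _ _ hS hT
    exact Submodule.add_mem _ hS hT
  · intro c T _ hT
    exact Submodule.smul_mem _ c hT

theorem coeff_gapPoly_self_ne_zero {ζ : Slot n m → K} (hζ : Function.Injective ζ)
    (w : Cell n m → Fin (2 * n)) : coeff ζ (gapPoly ζ w) w ≠ 0 := by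
  rw [coeff, Finset.prod_ne_zero_iff]
  intro x _ h
  exact ((eval_gapPoly_eq_zero_iff hζ w _ x.1).1 h).2 (mem_placed.2 (columns_pos w x))

theorem eq_of_coeff_gapPoly_ne_zero {ζ : Slot n m → K} (hζ : Function.Injective ζ)
    {w w' : Cell n m → Fin (2 * n)} (hw : IsAnti w) (hn : ∀ x, n ≤ (w x).val)
    (hw' : IsAnti w') (hn' : ∀ x, n ≤ (w' x).val) (h : cellCount w' = cellCount w)
    (hc : coeff ζ (gapPoly ζ w) w' ≠ 0) : w' = w := by
  classical
  refine columns_injective ((isColumns_columns hw' hn').eq_of_placed (isColumns_columns hw hn)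
    (columns_lt w) (fun q h0 hq p => ?_) fun q h0 hq p s hs hs' => ?_)
  · by_cases hp : p < 2 * n
    · rw [← cellCount_eq_card_placed w' (⟨p, hp⟩, ⟨q, hq⟩) h0,
        ← cellCount_eq_card_placed w (⟨p, hp⟩, ⟨q, hq⟩) h0, h]
    · rw [placed_columns_eq_empty (not_lt.1 hp) h0, placed_columns_eq_empty (not_lt.1 hp) h0]
  · rw [mem_placed] at hs
    have hp : p < s.deg := (isColumns_columns hw' hn').lt_of_pos (by omega)
    rw [coeff, Finset.prod_ne_zero_iff] at hc
    have hval : (w' ⟨s, ⟨p, hp⟩⟩).val = q := (columns_pos w' ⟨s, ⟨p, hp⟩⟩).symm.trans hs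
    refine hc ⟨s, ⟨p, hp⟩⟩ (Finset.mem_filter.2 ⟨Finset.mem_univ _, hn' _⟩)
      ((eval_gapPoly_eq_zero_iff hζ w _ s).2 ?_)
    simp only [hval]
    exact Finset.mem_sdiff.1 hs'

/-! ### Straightening by energy and conclusion -/

/-- The sum of the products of the positions and their entries. -/
def energy (w : Cell n m → Fin (2 * n)) : ℕ := ∑ x, x.pos.val * (w x).val

theorem energy_eq_of_cellCount {w w' : Cell n m → Fin (2 * n)} (h : cellCount w' = cellCount w) :
    energy w' = energy w := by
  rw [energy, energy, sum_eq_sum_cellCount w' fun a b => a.val * b.val,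
    sum_eq_sum_cellCount w fun a b => a.val * b.val, h]

/-- Rearrangement inequality: moving the larger entry to the earlier position lowers the sum. -/
theorem energy_swap_lt (w : Cell n m → Fin (2 * n)) {x y : Cell n m} (hxy : x.pos < y.pos)
    (hw : w x < w y) : energy (w ∘ Equiv.swap x y) < energy w := by
  have hne : x ≠ y := fun h => hxy.ne (h ▸ rfl)
  have hy : y ∈ (Finset.univ.erase x : Finset (Cell n m)) :=
    Finset.mem_erase.2 ⟨hne.symm, Finset.mem_univ _⟩
  rw [energy, energy, ← Finset.add_sum_erase _ _ (Finset.mem_univ x),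
    ← Finset.add_sum_erase _ (fun x => x.pos.val * (w x).val) (Finset.mem_univ x),
    ← Finset.add_sum_erase _ _ hy,
    ← Finset.add_sum_erase _ (fun x => x.pos.val * (w x).val) hy, ← add_assoc, ← add_assoc]
  refine add_lt_add_of_lt_of_le ?_ (le_of_eq ?_)
  · simp only [Function.comp_apply, Equiv.swap_apply_left, Equiv.swap_apply_right]
    have h1 := Fin.lt_def.1 hxy
    have h2 := Fin.lt_def.1 hw
    nlinarith
  · refine Finset.sum_congr rfl fun z hz => ?_
    simp only [Finset.mem_erase] at hz
    rw [Function.comp_apply, Equiv.swap_apply_of_ne_of_ne hz.2.1 hz.1]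

theorem content_comp_swap (w : Cell n m → Fin (2 * n)) (σ : Equiv.Perm (Cell n m))
    (j : Fin (2 * n)) : content (w ∘ σ) j = content w j := by
  rw [content, content]
  refine Finset.card_equiv σ fun x => ?_
  simp

theorem wedge_mem_of_not_isAnti {W : Submodule K (TensorSpace K n m)}
    {w : Cell n m → Fin (2 * n)} (hw : ¬ IsAnti w)
    (h : ∀ w' : Cell n m → Fin (2 * n), energy w' < energy w →
      (∀ j, content w' j = content w j) → wedge K w' ∈ W) : wedge K w ∈ W := by
  simp only [IsAnti, StrictAnti, not_forall] at hw
  obtain ⟨s, i, j, hij, hle⟩ := hw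
  rcases (not_lt.1 hle).lt_or_eq with hlt | heq
  · rw [← neg_neg (wedge K w), ← wedge_swap w s i j hij.ne]
    refine W.neg_mem (h _ (energy_swap_lt w ?_ hlt) (content_comp_swap w _))
    exact hij
  · rw [wedge_eq_zero w s i j hij.ne heq]
    exact W.zero_mem

theorem wedge_mem_span_fVec [CharZero K] {ζ : Slot n m → K} (hζ : Function.Injective ζ)
    {μ : Fin (2 * n) → ℕ} (hμ : ∀ j : Fin (2 * n), j.val < n → μ j = 0)
    (w : Cell n m → Fin (2 * n)) (hc : ∀ j, content w j = μ j) :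
    wedge K w ∈ Submodule.span K
      (Set.range fun B : fillingsOfWeight n m μ => fVec K ζ B.val) := by
  classical
  induction hE : energy w using Nat.strong_induction_on generalizing w with
  | _ E ih =>
    subst hE
    by_cases hw : IsAnti w
    swap
    · exact wedge_mem_of_not_isAnti hw fun w' h1 h2 =>
        ih _ h1 w' (fun j => (h2 j).trans (hc j)) rfl
    have hn := le_of_content_eq hμ hc
    obtain rfl : content w = μ := funext hc
    have hu := prod_gapPoly_mem ζ hw hn
    obtain ⟨c, hc0, h⟩ := prod_lowering_cyclicVec ζ (gapPoly ζ w) (cellPairs w)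
      fun a ha => mem_cellPairs hn ha
    rw [h] at hu
    have hu := (Submodule.smul_mem_iff _ hc0).1 hu
    have hw_mem : w ∈ Finset.univ.filter fun w' : Cell n m → Fin (2 * n) =>
        Matches w' (cellPairs w) :=
      Finset.mem_filter.2 ⟨Finset.mem_univ _, fun x => Or.inr (hn x),
        fun a _ => (count_cellPairs w a).symm⟩
    -- The term of `w` has a nonzero coefficient, so it suffices that all other terms lie in the
    -- span.
    rw [← Finset.add_sum_erase _ _ hw_mem, Submodule.add_mem_iff_left,
      Submodule.smul_mem_iff _ (coeff_gapPoly_self_ne_zero hζ w)] at hu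
    · exact hu
    refine Submodule.sum_mem _ fun w' hw' => ?_
    obtain ⟨hne, hw'⟩ := Finset.mem_erase.1 hw'
    have h1 : ∀ a : Fin (2 * n) × Fin (2 * n), n ≤ a.2.val → cellCount w' a = cellCount w a :=
      fun a ha => ((Finset.mem_filter.1 hw').2.2 a ha).trans (count_cellPairs w a)
    have hn' := le_of_cellCount_eq hn h1
    have h2 := cellCount_eq_of_le hn hn' h1
    by_cases ha : IsAnti w'
    · have h3 : coeff ζ (gapPoly ζ w) w' = 0 := by
        by_contra h3
        exact hne (eq_of_coeff_gapPoly_ne_zero hζ hw hn ha hn' h2 h3)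
      rw [h3, zero_smul]
      exact Submodule.zero_mem _
    -- Equal cell counts give `w'` the energy of `w`, so one transposition already brings it below
    -- and the induction hypothesis applies.
    · refine Submodule.smul_mem _ _ (wedge_mem_of_not_isAnti ha fun w'' h4 h5 => ?_)
      exact ih _ (h4.trans_eq (energy_eq_of_cellCount h2)) w''
        (fun j => (h5 j).trans (content_eq_of_cellCount h2 j)) rfl

theorem span_fVec_eq_weightSpace [CharZero K] {ζ : Slot n m → K} (hζ : Function.Injective ζ)
    {μ : Fin (2 * n) → ℕ} (hμ : ∀ j : Fin (2 * n), j.val < n → μ j = 0) :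
    Submodule.span K (Set.range fun B : fillingsOfWeight n m μ => fVec K ζ B.val) =
      weightSpace K n m μ := by
  refine le_antisymm (Submodule.span_le.2 ?_) ?_
  · rintro _ ⟨B, rfl⟩
    exact fVec_mem_weightSpace ζ hμ B.prop
  · rw [weightSpace_eq_span, Submodule.span_le]
    rintro _ ⟨w, rfl⟩
    exact wedge_mem_span_fVec hζ hμ w.val w.prop.2

/-- A spanning family with at most as many members as the dimension is independent. The bound holds
because `collOf` maps the wedge basis of the weight space onto `𝔹_μ`. -/
theorem linearIndependent_fVec [CharZero K] {ζ : Slot n m → K} (hζ : Function.Injective ζ)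
    {μ : Fin (2 * n) → ℕ} (hμ : ∀ j : Fin (2 * n), j.val < n → μ j = 0) :
    LinearIndependent K fun B : fillingsOfWeight n m μ => fVec K ζ B.val := by
  classical
  have := Fintype.ofFinite (fillingsOfWeight n m μ)
  rw [linearIndependent_iff_card_le_finrank_span, Set.finrank, span_fVec_eq_weightSpace hζ hμ,
    weightSpace_eq_span, finrank_span_eq_card (linearIndependent_wedge μ)]
  refine Fintype.card_le_of_surjective (fun w => ⟨collOf w.val, collOf_mem_fillingsOfWeight
    w.prop.1 (le_of_content_eq hμ w.prop.2) w.prop.2⟩) fun B => ?_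
  obtain ⟨w, hw, h⟩ := exists_eq_collOf hμ B.prop
  exact ⟨⟨w, hw⟩, Subtype.ext h⟩

end WeylEval

end

theorem mainTheorem5 (K : Type*) [Field K] [IsAlgClosed K] [CharZero K]
    (n : ℕ) (m : Fin (n - 1) → ℕ)
    (ζ : WeylEval.Slot n m → K) (hζ : Function.Injective ζ)
    (μ : Fin (2 * n) → ℕ) (hμ : ∀ j : Fin (2 * n), j.val < n → μ j = 0) :
    LinearIndependent K
      (fun B : WeylEval.fillingsOfWeight n m μ => WeylEval.fVec K ζ B.val) ∧
    Submodule.span K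
      (Set.range fun B : WeylEval.fillingsOfWeight n m μ => WeylEval.fVec K ζ B.val) =
        WeylEval.weightSpace K n m μ ∧
    (∑ j, μ j = ∑ s : WeylEval.Slot n m, s.deg →
      WeylEval.slWeightSpace K n m ζ μ = WeylEval.weightSpace K n m μ) :=
  ⟨WeylEval.linearIndependent_fVec hζ hμ, WeylEval.span_fVec_eq_weightSpace hζ hμ,
    WeylEval.slWeightSpace_eq_weightSpace ζ μ⟩
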